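/- Let $n\ge 1$ and let $\phi_\nu(x)=\prod_{j=1}^n\phi_{\nu_j}(x_j)$, $\nu\in\mathbb N_0^n$, with $\phi_k(y)=(2^k k!\sqrt\pi)^{-1/2}H_k(y)e^{-y^2/2}$ and $H_k(y)=(-1)^ke^{y^2}\frac{d^k}{dy^k}e^{-y^2}$, be the Hermite functions on $\mathbb R^n$, i.e. the eigenfunctions of $H=-\Delta+|x|^2$ for the eigenvalues $2|\nu|+n$. Consider functions $f:\mathbb R^n\to\mathbb C$ such that $f\phi_\nu$ is integrable for every $\nu$. For $\ell\in 2\mathbb N_0+n$ put $$P_\ell f(x)=\sum_{2|\nu|+n=\ell}\Big(\int_{\mathbb R^n} f\phi_\nu\,dy\Big)\phi_\nu(x),\qquad \|f\|_{\mathcal F^r_{p,2}}=\Big\|\Big(\sum_\ell \ell^{2r}|P_\ell f|^2\Big)^{1/2}\Big\|_{L^p(\mathbb R^n)}\in[0,\infty].$$ By $u(t,x)=e^{-itH}f(x)=\sum_\ell e^{-it\ell}P_\ell f(x)$, $t\in[0,2\pi]$, we mean a measurable function $u$ on $[0,2\pi]\times\mathbb R^n$ such that either (a) for almost every $x$ the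 series converges to $u(\cdot,x)$ in $L^2([0,2\pi])$, or (b) $f\in L^2(\mathbb R^n)$ and for almost every $t$ the series converges to $u(t,\cdot)$ in $L^2(\mathbb R^n)$. Let $0<p\le\infty$, $2\le q<\infty$ and $s_q=\frac12-\frac1q$. Then there is a constant $C'>0$, and for every real $s\ge s_q$ there is a constant $0<C<\infty$, where $C'$ depends only on $n,p,q$ and $C$ only on $n,p,q,s$, such that the following holds. If $\|f\|_{\mathcal F^s_{p,2}}<\infty$, then $e^{-itH}f$ exists in the sense (a), and if moreover $f\in L^2(\mathbb R^n)$ the same function is $e^{-itH}f$ in the sense (b). For all $f$ and all $u=e^{-itH}f$ as above (in either sense), $$C'\,\|f\|_{\mathcal F^0_{p,2}}\le\Big\|\,\|u(t,x)\|_{L^q_t([0,2\pi])}\Big\|_{L^p_x(\mathbb R^n)}\le C\,\|f\|_{\mathcal F^s_{p,2}},$$ as inequalities in $[0,\infty]$. -/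

import Mathlib

open MeasureTheory Filter Topology
open scoped ENNReal NNReal

noncomputable section

namespace HermiteTL

/-- The (physicists') Hermite polynomial `H_k(x) = (-1)^k e^{x^2} (d/dx)^k e^{-x^2}`. -/
def hermitePoly (k : ℕ) (x : ℝ) : ℝ :=
  (-1) ^ k * Real.exp (x ^ 2) * iteratedDeriv k (fun y : ℝ => Real.exp (-y ^ 2)) x

/-- The normalized one-dimensional Hermite function
`(2^k k! √π)^{-1/2} H_k(x) e^{-x^2/2}`. -/
def hermiteFun1 (k : ℕ) (x : ℝ) : ℝ :=
  (2 ^ k * (Nat.factorial k : ℝ) * Real.sqrt Real.pi) ^ (-(1 / 2) : ℝ)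
    * hermitePoly k x * Real.exp (-(1 / 2) * x ^ 2)

/-- The Hermite function `φ_ν(x) = ∏_j φ_{ν_j}(x_j)` on `ℝⁿ`: the eigenfunction of
`H = -Δ + |x|^2` for the eigenvalue `2|ν| + n`. -/
def hermiteFun {n : ℕ} (ν : Fin n → ℕ) (x : EuclideanSpace ℝ (Fin n)) : ℝ :=
  ∏ j, hermiteFun1 (ν j) (x j)

/-- All Hermite coefficients of `f` are defined: `f φ_ν` is integrable for every `ν`. -/
def HasHermiteCoeffs {n : ℕ} (f : EuclideanSpace ℝ (Fin n) → ℂ) : Prop :=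
  ∀ ν : Fin n → ℕ, Integrable (fun x => f x * (hermiteFun ν x : ℂ)) volume

/-- The Hermite coefficient `∫ f φ_ν dx`. -/
def hermiteCoeff {n : ℕ} (f : EuclideanSpace ℝ (Fin n) → ℂ) (ν : Fin n → ℕ) : ℂ :=
  ∫ x, f x * (hermiteFun ν x : ℂ)

/-- The eigenprojection `P_ℓ f` of `H` for the eigenvalue `ℓ = 2k + n`: the (finite) sum of
`(∫ f φ_ν) φ_ν` over all multi-indices `ν` with `|ν| = k`. -/
def hermiteProj {n : ℕ} (k : ℕ) (f : EuclideanSpace ℝ (Fin n) → ℂ)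
    (x : EuclideanSpace ℝ (Fin n)) : ℂ :=
  ∑ ν ∈ Finset.piAntidiag (Finset.univ : Finset (Fin n)) k,
    hermiteCoeff f ν * (hermiteFun ν x : ℂ)

/-- The Triebel–Lizorkin (quasi-)norm
`‖ (∑_ℓ ℓ^{rq} |P_ℓ f|^q)^{1/q} ‖_{L^p(ℝⁿ)}` with `ℓ = 2k + n`, as an element of `[0, ∞]`
(for a finite exponent `q`). The space consists of those `f` for which it is finite. -/
def tlNorm {n : ℕ} (r : ℝ) (p : ℝ≥0∞) (q : ℝ) (f : EuclideanSpace ℝ (Fin n) → ℂ) : ℝ≥0∞ :=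
  eLpNorm (fun x : EuclideanSpace ℝ (Fin n) =>
    (∑' k : ℕ, ((2 * k + n : ℕ) : ℝ≥0∞) ^ (r * q) * ‖hermiteProj k f x‖ₑ ^ q) ^ (1 / q))
    p volume

/-- The time interval `[0, 2π]` with Lebesgue measure. -/
def timeMeasure : Measure ℝ := volume.restrict (Set.Icc 0 (2 * Real.pi))

/-- The partial sum `∑_{k < N} e^{-itℓ} P_ℓ f(x)`, `ℓ = 2k + n`, of `e^{-itH} f`. -/
def flowPartialSum {n : ℕ} (f : EuclideanSpace ℝ (Fin n) → ℂ) (N : ℕ)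
    (t : ℝ) (x : EuclideanSpace ℝ (Fin n)) : ℂ :=
  ∑ k ∈ Finset.range N,
    Complex.exp (-(Complex.I * (t : ℂ) * ((2 * k + n : ℕ) : ℂ))) * hermiteProj k f x

/-- `u(t, x) = ∑_ℓ e^{-itℓ} P_ℓ f(x)` as a function of `t ∈ [0, 2π]`, for almost every `x`:
the series converges to `u(·, x)` in `L^2([0, 2π])`. -/
structure IsPointwiseFlow {n : ℕ} (f : EuclideanSpace ℝ (Fin n) → ℂ)
    (u : ℝ → EuclideanSpace ℝ (Fin n) → ℂ) : Prop where
  measurable : AEStronglyMeasurable (Function.uncurry u) (timeMeasure.prod volume)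
  tendsto : ∀ᵐ x ∂(volume : Measure (EuclideanSpace ℝ (Fin n))),
    Tendsto (fun N => eLpNorm (fun t => flowPartialSum f N t x - u t x) 2 timeMeasure)
      atTop (𝓝 0)

/-- `u(t, ·) = e^{-itH} f` in `L^2(ℝⁿ)`, for almost every `t ∈ [0, 2π]`: the spectral series
`∑_ℓ e^{-itℓ} P_ℓ f` converges to `u(t, ·)` in `L^2(ℝⁿ)`. -/
structure IsL2Flow {n : ℕ} (f : EuclideanSpace ℝ (Fin n) → ℂ)
    (u : ℝ → EuclideanSpace ℝ (Fin n) → ℂ) : Prop where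
  memLp : MemLp f 2 volume
  measurable : AEStronglyMeasurable (Function.uncurry u) (timeMeasure.prod volume)
  tendsto : ∀ᵐ t ∂timeMeasure,
    Tendsto (fun N => eLpNorm (fun x => flowPartialSum f N t x - u t x) 2 volume)
      atTop (𝓝 0)

/-- The mixed norm `‖u‖_{L^p_x(ℝⁿ, L^q_t[0, 2π])}`, in `[0, ∞]`. -/
def mixedNorm {n : ℕ} (p q : ℝ≥0∞) (u : ℝ → EuclideanSpace ℝ (Fin n) → ℂ) : ℝ≥0∞ :=
  eLpNorm (fun x : EuclideanSpace ℝ (Fin n) => eLpNorm (fun t => u t x) q timeMeasure) p volume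

end HermiteTL

end

/-! For fixed `x` the flow is a Fourier series in time with coefficients `P_ℓ f(x)`, so both
inequalities are statements about one function on `[0, 2π]`, applied pointwise in `x`. The `L^p`
(quasi-)norm in `x` enters only through its monotonicity, which is why every `0 < p ≤ ∞` is allowed.

The exponentials `e^{-itℓ}` are orthogonal on `[0, 2π]`. Bessel's inequality bounds `∑ |P_ℓ f(x)|²`
by the squared `L²_t` norm, and Hölder on a finite interval passes to `L^q_t`: this is the lower
bound (`exists_tlNorm_le`). The upper bound (`exists_mixedNorm_le`) is the endpoint Sobolev
embedding `H^{1/2-1/q} ⊆ L^q` (`exists_eLpNorm_le_of_phase_series`). Its proof cuts the series at a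
frequency depending on the height `l`: low frequencies are bounded uniformly by Cauchy–Schwarz, high
ones in `L²`, and integrating over all heights costs no logarithm.

For `f ∈ L²` the two senses of `e^{-itH} f` agree (`isPointwiseFlow_iff_isL2Flow`): the terms are
orthogonal in `x` as well as in `t`, so Tonelli exchanges the tail estimates. Existence
(`exists_isPointwiseFlow`) is obtained after damping the series by a weight in `x`. -/

namespace HermiteTL

/-! ### Orthonormality of the Hermite functions -/

/-- The Hermite polynomials, by the recursion `H_{k+1} = 2 X H_k - H_k'`. -/
noncomputable def hermiteRec : ℕ → Polynomial ℝ
  | 0 => 1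
  | k + 1 => 2 * Polynomial.X * hermiteRec k - Polynomial.derivative (hermiteRec k)

/-- With `P = H_k` this matches the recursion to the Rodrigues formula; with `P = H_k Q` it is the
integration by parts behind orthogonality. -/
theorem hasDerivAt_eval_mul_exp_neg_sq (P : Polynomial ℝ) (x : ℝ) :
    HasDerivAt (fun y : ℝ => P.eval y * Real.exp (-y ^ 2))
      (-((2 * Polynomial.X * P - Polynomial.derivative P).eval x * Real.exp (-x ^ 2))) x := by
  have h1 : HasDerivAt (fun y : ℝ => Real.exp (-y ^ 2)) (Real.exp (-x ^ 2) * -(2 * x)) x := by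
    have := ((hasDerivAt_pow 2 x).neg).exp
    simpa using this
  refine ((P.hasDerivAt x).mul h1).congr_deriv ?_
  simp
  ring

theorem iteratedDeriv_exp_neg_sq (k : ℕ) :
    iteratedDeriv k (fun y : ℝ => Real.exp (-y ^ 2)) =
      fun x => (-1) ^ k * ((hermiteRec k).eval x * Real.exp (-x ^ 2)) := by
  induction k with
  | zero => ext x; simp [hermiteRec]
  | succ k ih =>
    rw [iteratedDeriv_succ, ih]
    ext x
    rw [((hasDerivAt_eval_mul_exp_neg_sq (hermiteRec k) x).const_mul _).deriv, hermiteRec]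
    ring

theorem hermitePoly_eq_eval (k : ℕ) (x : ℝ) : hermitePoly k x = (hermiteRec k).eval x := by
  rw [hermitePoly, iteratedDeriv_exp_neg_sq]
  have h : Real.exp (x ^ 2) * Real.exp (-x ^ 2) = 1 := by rw [← Real.exp_add]; simp
  have h' : ((-1 : ℝ) ^ k) * (-1) ^ k = 1 := by rw [← mul_pow]; simp
  linear_combination (hermiteRec k).eval x * (h' + (-1) ^ k * (-1) ^ k * h)

theorem derivative_hermiteRec_succ (k : ℕ) :
    Polynomial.derivative (hermiteRec (k + 1)) = Polynomial.C (2 * (k + 1 : ℝ)) * hermiteRec k := by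
  induction k with
  | zero => simp [hermiteRec]; rfl
  | succ k ih =>
    rw [hermiteRec, Polynomial.derivative_sub, Polynomial.derivative_mul, ih,
      Polynomial.derivative_C_mul]
    have : hermiteRec (k + 1) =
      2 * Polynomial.X * hermiteRec k - Polynomial.derivative (hermiteRec k) := rfl
    have hd : Polynomial.derivative (2 * Polynomial.X : Polynomial ℝ) = 2 := by simp
    have hc : Polynomial.C (2 * (((k + 1 : ℕ) : ℝ) + 1)) =
        Polynomial.C (2 * (k + 1 : ℝ)) + 2 := by
      rw [← map_ofNat Polynomial.C 2, ← Polynomial.C_add]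
      congr 1
      push_cast
      ring
    rw [hd, hc]
    linear_combination -Polynomial.C (2 * (k + 1 : ℝ)) * this

theorem integrable_eval_mul_exp_neg_sq (P : Polynomial ℝ) :
    Integrable (fun x : ℝ => P.eval x * Real.exp (-x ^ 2)) := by
  induction P using Polynomial.induction_on' with
  | add P Q hP hQ => simpa only [Polynomial.eval_add, add_mul] using! hP.add hQ
  | monomial k a =>
    have := (integrable_rpow_mul_exp_neg_mul_sq (b := 1) one_pos
      (s := k) (by have : (0 : ℝ) ≤ k := k.cast_nonneg; linarith)).const_mul a
    simpa [mul_assoc] using this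

/-- Up to sign, the difference of the integrands is the derivative of `H_k Q e^{-x²}`, which
integrates to zero. -/
theorem integral_hermiteRec_succ_mul (k : ℕ) (Q : Polynomial ℝ) :
    ∫ x : ℝ, (hermiteRec (k + 1) * Q).eval x * Real.exp (-x ^ 2) =
      ∫ x : ℝ, (hermiteRec k * Polynomial.derivative Q).eval x * Real.exp (-x ^ 2) := by
  have h := integral_eq_zero_of_hasDerivAt_of_integrable
    (hasDerivAt_eval_mul_exp_neg_sq (hermiteRec k * Q))
    (integrable_eval_mul_exp_neg_sq _).neg (integrable_eval_mul_exp_neg_sq _)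
  rw [← sub_eq_zero, ← integral_sub (integrable_eval_mul_exp_neg_sq _)
    (integrable_eval_mul_exp_neg_sq _), ← neg_eq_zero, ← integral_neg, ← h]
  congr 1
  ext x
  simp [hermiteRec]
  ring

/-- Integration by parts and `H_{k+1}' = 2(k+1) H_k` lower both indices together, until a constant
is differentiated or the Gaussian integral remains. -/
theorem integral_hermiteRec_mul_hermiteRec (j k : ℕ) :
    ∫ x : ℝ, (hermiteRec j * hermiteRec k).eval x * Real.exp (-x ^ 2) =
      if j = k then 2 ^ k * (k.factorial : ℝ) * √Real.pi else 0 := by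
  induction j generalizing k with
  | zero =>
    cases k with
    | zero => simpa [hermiteRec] using integral_gaussian 1
    | succ k => rw [mul_comm, integral_hermiteRec_succ_mul]; simp [hermiteRec]
  | succ j ih =>
    cases k with
    | zero => rw [integral_hermiteRec_succ_mul]; simp [hermiteRec]
    | succ k =>
      rw [integral_hermiteRec_succ_mul, derivative_hermiteRec_succ]
      have : ∀ x : ℝ, (hermiteRec j * (Polynomial.C (2 * (k + 1 : ℝ)) * hermiteRec k)).eval x
          * Real.exp (-x ^ 2) =
          (2 * (k + 1 : ℝ)) * ((hermiteRec j * hermiteRec k).eval x * Real.exp (-x ^ 2)) := by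
        intro x; simp; ring
      simp_rw [this]
      rw [integral_const_mul, ih]
      by_cases h : j = k
      · simp [h, Nat.factorial_succ]; ring
      · simp [h]

theorem hermiteFun1_mul_hermiteFun1 (j k : ℕ) (x : ℝ) :
    hermiteFun1 j x * hermiteFun1 k x =
      ((2 ^ j * (Nat.factorial j : ℝ) * √Real.pi) ^ (-(1 / 2) : ℝ)
        * (2 ^ k * (Nat.factorial k : ℝ) * √Real.pi) ^ (-(1 / 2) : ℝ))
        * ((hermiteRec j * hermiteRec k).eval x * Real.exp (-x ^ 2)) := by
  have : Real.exp (-x ^ 2) = Real.exp (-(1 / 2) * x ^ 2) * Real.exp (-(1 / 2) * x ^ 2) := by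
    rw [← Real.exp_add]; congr 1; ring
  rw [this, hermiteFun1, hermiteFun1, hermitePoly_eq_eval, hermitePoly_eq_eval,
    Polynomial.eval_mul]
  ring

theorem integrable_hermiteFun1_mul (j k : ℕ) :
    Integrable (fun x => hermiteFun1 j x * hermiteFun1 k x) := by
  simp_rw [hermiteFun1_mul_hermiteFun1]
  exact (integrable_eval_mul_exp_neg_sq _).const_mul _

theorem integral_hermiteFun1_mul (j k : ℕ) :
    ∫ x, hermiteFun1 j x * hermiteFun1 k x = if j = k then 1 else 0 := by
  simp_rw [hermiteFun1_mul_hermiteFun1]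
  rw [integral_const_mul, integral_hermiteRec_mul_hermiteRec]
  by_cases h : j = k
  · subst h
    have hpos : 0 < 2 ^ j * (j.factorial : ℝ) * √Real.pi := by positivity
    rw [if_pos rfl, if_pos rfl, ← Real.rpow_add hpos]
    norm_num
    rw [Real.rpow_neg_one]
    exact inv_mul_cancel₀ hpos.ne'
  · simp [h]

theorem continuous_hermiteFun1 (k : ℕ) : Continuous (hermiteFun1 k) := by
  have : hermiteFun1 k = fun x => (2 ^ k * (Nat.factorial k : ℝ) * √Real.pi) ^ (-(1 / 2) : ℝ)
    * (hermiteRec k).eval x * Real.exp (-(1 / 2) * x ^ 2) := by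
    ext x; rw [hermiteFun1, hermitePoly_eq_eval]
  rw [this]
  fun_prop

section HermiteFunctions

variable {n : ℕ}

theorem continuous_hermiteFun (ν : Fin n → ℕ) : Continuous (hermiteFun ν) := by
  unfold hermiteFun
  exact continuous_finsetProd _ fun j _ => (continuous_hermiteFun1 _).comp (by fun_prop)

theorem integrable_hermiteFun_mul (ν μ : Fin n → ℕ) :
    Integrable (fun x => hermiteFun ν x * hermiteFun μ x) := by
  have h := Integrable.fintype_prod
    (f := fun j : Fin n => fun x : ℝ => hermiteFun1 (ν j) x * hermiteFun1 (μ j) x)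
    (μ := fun _ => volume) (fun j => integrable_hermiteFun1_mul _ _)
  have := (PiLp.volume_preserving_ofLp (Fin n)).integrable_comp_of_integrable h
  simpa [Function.comp_def, hermiteFun, Finset.prod_mul_distrib] using this

theorem integral_hermiteFun_mul (ν μ : Fin n → ℕ) :
    ∫ x, hermiteFun ν x * hermiteFun μ x = if ν = μ then 1 else 0 := by
  have h := integral_fintype_prod_volume_eq_prod
    (fun j : Fin n => fun x : ℝ => hermiteFun1 (ν j) x * hermiteFun1 (μ j) x)
  rw [← (PiLp.volume_preserving_ofLp (Fin n)).integral_comp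
    (MeasurableEquiv.toLp 2 (Fin n → ℝ)).symm.measurableEmbedding] at h
  simp_rw [hermiteFun, ← Finset.prod_mul_distrib]
  rw [h]
  simp_rw [integral_hermiteFun1_mul]
  by_cases hν : ν = μ
  · simp [hν]
  · rw [if_neg hν]
    obtain ⟨j, hj⟩ := Function.ne_iff.mp hν
    exact Finset.prod_eq_zero (Finset.mem_univ j) (if_neg hj)

theorem memLp_hermiteFun (ν : Fin n → ℕ) :
    MemLp (fun x => (hermiteFun ν x : ℂ)) 2 := by
  have hm : AEStronglyMeasurable (hermiteFun ν) volume :=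
    (continuous_hermiteFun ν).aestronglyMeasurable
  have : MemLp (hermiteFun ν) 2 := by
    rw [memLp_two_iff_integrable_sq hm]
    simpa [sq] using integrable_hermiteFun_mul ν ν
  exact this.ofReal

end HermiteFunctions

/-! ### Orthogonal series in `L²` -/

section Orthogonal

variable {α β ι : Type*} [MeasurableSpace α] [MeasurableSpace β] {μ : Measure α} {ν : Measure β}

theorem eLpNorm_two_sq (f : α → ℂ) : eLpNorm f 2 μ ^ 2 = ∫⁻ x, ‖f x‖ₑ ^ 2 ∂μ := by
  simpa using eLpNorm_nnreal_pow_eq_lintegral (μ := μ) (f := f) (p := 2) two_ne_zero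

theorem eLpNorm_add_sq_of_orthogonal {f g : α → ℂ} (hf : MemLp f 2 μ) (hg : MemLp g 2 μ)
    (h : ∫ x, (starRingEnd ℂ) (f x) * g x ∂μ = 0) :
    eLpNorm (fun x => f x + g x) 2 μ ^ 2 = eLpNorm f 2 μ ^ 2 + eLpNorm g 2 μ ^ 2 := by
  have hin : inner ℂ (hf.toLp f) (hg.toLp g) = 0 := by
    rw [L2.inner_def, ← h]
    refine integral_congr_ae ?_
    filter_upwards [hf.coeFn_toLp, hg.coeFn_toLp] with x hx hy
    simp [hx, hy, mul_comm]
  have key := norm_add_sq_eq_norm_sq_add_norm_sq_of_inner_eq_zero _ _ hin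
  rw [← MemLp.toLp_add] at key
  have e1 : ∀ {k : α → ℂ} (hk : MemLp k 2 μ),
      eLpNorm k 2 μ ^ 2 = ENNReal.ofReal (‖hk.toLp k‖ * ‖hk.toLp k‖) := by
    intro k hk
    rw [← Lp.enorm_toLp (hf := hk), ENNReal.ofReal_mul (norm_nonneg _), ofReal_norm, sq]
  rw [e1 hf, e1 hg, ← ENNReal.ofReal_add (by positivity) (by positivity), ← key]
  exact e1 (hf.add hg)

/-- The functions `g i` are square integrable and pairwise orthogonal. -/
structure IsOrthogonal (μ : Measure α) (g : ι → α → ℂ) : Prop where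
  memLp : ∀ i, MemLp (g i) 2 μ
  orthogonal : ∀ i j, i ≠ j → ∫ x, (starRingEnd ℂ) (g i x) * g j x ∂μ = 0

theorem memLp_two_star {f : α → ℂ} (hf : MemLp f 2 μ) :
    MemLp (fun x => (starRingEnd ℂ) (f x)) 2 μ := hf.star

theorem integrable_star_mul {f g : α → ℂ} (hf : MemLp f 2 μ) (hg : MemLp g 2 μ) :
    Integrable (fun x => (starRingEnd ℂ) (f x) * g x) μ :=
  (memLp_two_star hf).integrable_mul hg

theorem IsOrthogonal.integral_star_sum_mul_sum {g : ι → α → ℂ} (hg : IsOrthogonal μ g)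
    {s t : Finset ι} (hst : Disjoint s t) (c d : ι → ℂ) :
    ∫ x, (starRingEnd ℂ) (∑ i ∈ s, c i * g i x) * (∑ j ∈ t, d j * g j x) ∂μ = 0 := by
  have hI : ∀ i j, Integrable
      (fun x => (starRingEnd ℂ) (c i * g i x) * (d j * g j x)) μ := fun i j =>
    integrable_star_mul ((hg.memLp i).const_mul (c i)) ((hg.memLp j).const_mul (d j))
  simp_rw [map_sum, Finset.sum_mul_sum]
  rw [integral_finsetSum _ fun i _ => integrable_finsetSum _ fun j _ => hI i j]
  refine Finset.sum_eq_zero fun i hi => ?_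
  rw [integral_finsetSum _ fun j _ => hI i j]
  refine Finset.sum_eq_zero fun j hj => ?_
  have : ∀ x, (starRingEnd ℂ) (c i * g i x) * (d j * g j x) =
      ((starRingEnd ℂ) (c i) * d j) * ((starRingEnd ℂ) (g i x) * g j x) := by
    intro x; rw [map_mul]; ring
  simp_rw [this]
  rw [integral_const_mul, hg.orthogonal i j (fun h => Finset.disjoint_left.mp hst hi (h ▸ hj)),
    mul_zero]

theorem IsOrthogonal.eLpNorm_sum_sq {g : ι → α → ℂ} (hg : IsOrthogonal μ g) (s : Finset ι) :
    eLpNorm (fun x => ∑ i ∈ s, g i x) 2 μ ^ 2 = ∑ i ∈ s, eLpNorm (g i) 2 μ ^ 2 := by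
  classical
  induction s using Finset.induction_on with
  | empty => simp
  | insert i s hi ih =>
    rw [Finset.sum_insert hi, ← ih]
    simp_rw [Finset.sum_insert hi]
    refine eLpNorm_add_sq_of_orthogonal (hg.memLp i) (memLp_finsetSum _ fun j _ => hg.memLp j) ?_
    simpa using hg.integral_star_sum_mul_sum (Finset.disjoint_singleton_left.mpr hi) 1 1

theorem IsOrthogonal.eLpNorm_sum_range_sub_sq {g : ℕ → α → ℂ} (hg : IsOrthogonal μ g) {M N : ℕ}
    (h : N ≤ M) :
    eLpNorm (fun x => ∑ k ∈ Finset.range N, g k x - ∑ k ∈ Finset.range M, g k x) 2 μ ^ 2 ≤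
      ∑' k, eLpNorm (g (k + N)) 2 μ ^ 2 := by
  have : (fun x => ∑ k ∈ Finset.range N, g k x - ∑ k ∈ Finset.range M, g k x) =
      -fun x => ∑ k ∈ Finset.Ico N M, g k x := by
    ext x
    simp [Finset.sum_Ico_eq_sub _ h]
  rw [this, eLpNorm_neg, hg.eLpNorm_sum_sq, Finset.sum_Ico_eq_sum_range]
  simp_rw [add_comm N]
  exact ENNReal.sum_le_tsum (f := fun k => eLpNorm (g (k + N)) 2 μ ^ 2) _

theorem rpow_half_sq (a : ℝ≥0∞) : (a ^ (1 / 2 : ℝ)) ^ 2 = a := by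
  rw [← ENNReal.rpow_natCast, ← ENNReal.rpow_mul]
  norm_num

theorem le_rpow_half_of_sq_le {a b : ℝ≥0∞} (h : a ^ 2 ≤ b) : a ≤ b ^ (1 / 2 : ℝ) := by
  rw [← rpow_half_sq b] at h
  exact (ENNReal.pow_le_pow_left_iff two_ne_zero).mp h

/-- If a subsequence of the partial sums of an orthogonal series converges to `u` in `L²`, then
the distance of every partial sum to `u` is at most the tail of the series. -/
theorem IsOrthogonal.eLpNorm_sum_sub_limit_sq_le {g : ℕ → α → ℂ} (hg : IsOrthogonal μ g)
    {u : α → ℂ} (hu : AEStronglyMeasurable u μ) {φ : ℕ → ℕ} (hφ : Tendsto φ atTop atTop)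
    (h : Tendsto (fun j => eLpNorm (fun x => ∑ k ∈ Finset.range (φ j), g k x - u x) 2 μ)
      atTop (𝓝 0)) (N : ℕ) :
    eLpNorm (fun x => ∑ k ∈ Finset.range N, g k x - u x) 2 μ ^ 2 ≤
      ∑' k, eLpNorm (g (k + N)) 2 μ ^ 2 := by
  have hm : ∀ M, AEStronglyMeasurable (fun x => ∑ k ∈ Finset.range M, g k x) μ := fun M =>
    (memLp_finsetSum _ fun j _ => hg.memLp j).1
  set T := ∑' k, eLpNorm (g (k + N)) 2 μ ^ 2
  have key : eLpNorm (fun x => ∑ k ∈ Finset.range N, g k x - u x) 2 μ ≤ T ^ (1 / 2 : ℝ) := by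
    -- Triangle inequality through the partial sum of length `φ j ≥ N`: the first piece is a block
    -- of the tail, the second tends to zero.
    have h' := (tendsto_const_nhds (x := T ^ (1 / 2 : ℝ))).add h
    rw [add_zero] at h'
    refine ge_of_tendsto h' ?_
    filter_upwards [hφ.eventually_ge_atTop N] with j hj
    have e : (fun x => ∑ k ∈ Finset.range N, g k x - u x) =
        (fun x => ∑ k ∈ Finset.range N, g k x - ∑ k ∈ Finset.range (φ j), g k x) +
        fun x => ∑ k ∈ Finset.range (φ j), g k x - u x := by
      ext x; simp
    rw [e]
    refine (eLpNorm_add_le ((hm _).sub (hm _)) ((hm _).sub hu) one_le_two).trans ?_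
    exact add_le_add (le_rpow_half_of_sq_le (hg.eLpNorm_sum_range_sub_sq hj)) le_rfl
  calc _ ≤ (T ^ (1 / 2 : ℝ)) ^ 2 := by gcongr
    _ = T := rpow_half_sq T

theorem tendsto_zero_of_sq {f : ℕ → ℝ≥0∞} (h : Tendsto (fun N => f N ^ 2) atTop (𝓝 0)) :
    Tendsto f atTop (𝓝 0) := by
  have := h.ennrpow_const (1 / 2 : ℝ)
  rw [ENNReal.zero_rpow_of_pos (by norm_num)] at this
  convert! this using 2 with N
  rw [← ENNReal.rpow_natCast, ← ENNReal.rpow_mul]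
  norm_num

/-- Almost everywhere arguments yield convergence along a subsequence only; the tail bound upgrades
it to the full sequence. -/
theorem IsOrthogonal.tendsto_of_subseq {g : ℕ → α → ℂ} (hg : IsOrthogonal μ g)
    (hs : ∑' k, eLpNorm (g k) 2 μ ^ 2 ≠ ∞)
    {u : α → ℂ} (hu : AEStronglyMeasurable u μ) {φ : ℕ → ℕ} (hφ : Tendsto φ atTop atTop)
    (h : Tendsto (fun j => eLpNorm (fun x => ∑ k ∈ Finset.range (φ j), g k x - u x) 2 μ)
      atTop (𝓝 0)) :
    Tendsto (fun N => eLpNorm (fun x => ∑ k ∈ Finset.range N, g k x - u x) 2 μ)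
      atTop (𝓝 0) :=
  tendsto_zero_of_sq <| tendsto_of_tendsto_of_tendsto_of_le_of_le tendsto_const_nhds
    (ENNReal.tendsto_sum_nat_add _ hs) (fun _ => zero_le)
    (hg.eLpNorm_sum_sub_limit_sq_le hu hφ h)

/-- Bessel's half of Parseval's identity for the limit of an orthogonal series. -/
theorem IsOrthogonal.tsum_le_eLpNorm_sq {g : ℕ → α → ℂ} (hg : IsOrthogonal μ g)
    {u : α → ℂ} (hu : AEStronglyMeasurable u μ)
    (h : Tendsto (fun N => eLpNorm (fun x => ∑ k ∈ Finset.range N, g k x - u x) 2 μ)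
      atTop (𝓝 0)) :
    ∑' k, eLpNorm (g k) 2 μ ^ 2 ≤ eLpNorm u 2 μ ^ 2 := by
  have hm : ∀ M, AEStronglyMeasurable (fun x => ∑ k ∈ Finset.range M, g k x) μ := fun M =>
    (memLp_finsetSum _ fun j _ => hg.memLp j).1
  have h1 := ENNReal.tendsto_nat_tsum (fun k => eLpNorm (g k) 2 μ ^ 2)
  have h2 := ((ENNReal.continuous_pow 2).tendsto _).comp (h.add_const (eLpNorm u 2 μ))
  rw [zero_add] at h2
  refine le_of_tendsto_of_tendsto' h1 h2 fun N => ?_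
  rw [← hg.eLpNorm_sum_sq]
  have e : (fun x => ∑ k ∈ Finset.range N, g k x) =
      (fun x => ∑ k ∈ Finset.range N, g k x - u x) + u := by
    ext x; simp
  simp only [Function.comp_apply]
  gcongr
  conv_lhs => rw [e]
  exact eLpNorm_add_le ((hm _).sub hu) hu one_le_two

theorem IsOrthogonal.exists_limit {g : ℕ → α → ℂ} (hg : IsOrthogonal μ g)
    (hs : ∑' k, eLpNorm (g k) 2 μ ^ 2 ≠ ∞) :
    ∃ u : α → ℂ, MemLp u 2 μ ∧
      Tendsto (fun N => eLpNorm (fun x => ∑ k ∈ Finset.range N, g k x - u x) 2 μ)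
        atTop (𝓝 0) := by
  have hm : ∀ M, MemLp (fun x => ∑ k ∈ Finset.range M, g k x) 2 μ := fun M =>
    memLp_finsetSum _ fun j _ => hg.memLp j
  have hc : CauchySeq fun M => (hm M).toLp := by
    refine Metric.cauchySeq_iff'.mpr fun ε hε => ?_
    have h0 := tendsto_zero_of_sq (f := fun N =>
        (∑' k, eLpNorm (g (k + N)) 2 μ ^ 2) ^ (1 / 2 : ℝ)) (by
      simp_rw [rpow_half_sq]
      exact ENNReal.tendsto_sum_nat_add _ hs)
    obtain ⟨N, hN⟩ := (h0.eventually_lt_const (ENNReal.ofReal_pos.mpr hε)).exists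
    refine ⟨N, fun M hM => ?_⟩
    rw [← edist_lt_ofReal, edist_comm, Lp.edist_toLp_toLp]
    exact (le_rpow_half_of_sq_le (hg.eLpNorm_sum_range_sub_sq hM)).trans_lt hN
  obtain ⟨u, hu⟩ := cauchySeq_tendsto_of_complete hc
  refine ⟨u, Lp.memLp u, ?_⟩
  rw [tendsto_iff_edist_tendsto_0] at hu
  refine hu.congr fun M => ?_
  rw [Lp.edist_def]
  refine eLpNorm_congr_ae ?_
  filter_upwards [(hm M).coeFn_toLp] with x hx
  simp [hx]

/-- Convergence in `L²` of the product space gives convergence of almost every slice, if almost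
every slice is an orthogonal series with summable squares. -/
theorem ae_tendsto_of_tendsto_lintegral [SFinite ν] {g : ℕ → α → β → ℂ} {u : α → β → ℂ}
    (hm : ∀ N, AEStronglyMeasurable
      (fun z : α × β => ∑ k ∈ Finset.range N, g k z.1 z.2 - u z.1 z.2) (μ.prod ν))
    (hu : ∀ᵐ a ∂μ, AEStronglyMeasurable (u a) ν)
    (hg : ∀ᵐ a ∂μ, IsOrthogonal ν (fun k => g k a))
    (hs : ∀ᵐ a ∂μ, ∑' k, eLpNorm (g k a) 2 ν ^ 2 ≠ ∞)
    (h : Tendsto (fun N => ∫⁻ a, eLpNorm (fun b => ∑ k ∈ Finset.range N, g k a b - u a b) 2 ν ^ 2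
      ∂μ) atTop (𝓝 0)) :
    ∀ᵐ a ∂μ, Tendsto (fun N => eLpNorm (fun b => ∑ k ∈ Finset.range N, g k a b - u a b) 2 ν)
      atTop (𝓝 0) := by
  set G : ℕ → α → ℝ≥0∞ := fun N a =>
    eLpNorm (fun b => ∑ k ∈ Finset.range N, g k a b - u a b) 2 ν ^ 2
  have hG : ∀ N, AEMeasurable (G N) μ := by
    intro N
    simp only [G, eLpNorm_two_sq]
    exact ((hm N).enorm.pow_const 2).lintegral_prod_right'
  -- Along `φ` the integrated errors are at most `2^{-j}`, so their sum over `j` is finite for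
  -- almost every `a` and the slice errors tend to zero.
  obtain ⟨φ, hφ, hφG⟩ := extraction_forall_of_eventually'
    (P := fun j N => ∫⁻ a, G N a ∂μ ≤ (2⁻¹ : ℝ≥0∞) ^ j) fun j => by
      obtain ⟨N, hN⟩ := eventually_atTop.mp (h.eventually_le_const
        (u := (2⁻¹ : ℝ≥0∞) ^ j) (ENNReal.pow_pos (by simp) j))
      exact ⟨N, fun b hb => hN b hb⟩
  have hfin : ∫⁻ a, ∑' j, G (φ j) a ∂μ ≠ ∞ := by
    rw [lintegral_tsum fun j => hG _]
    refine ne_top_of_le_ne_top ?_ (ENNReal.tsum_le_tsum hφG)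
    rw [ENNReal.tsum_geometric]
    simp
  have hae := ae_lt_top' (AEMeasurable.tsum fun j => hG (φ j)) hfin
  filter_upwards [hae, hu, hg, hs] with a ha hua hga hsa
  refine hga.tendsto_of_subseq hsa hua hφ.tendsto_atTop ?_
  exact tendsto_zero_of_sq (ENNReal.tendsto_atTop_zero_of_tsum_ne_top ha.ne)

/-- The tail bound in the slices at fixed `b`, integrated over `b`, is a tail of the finite double
sum `hs`. Tonelli reads the same quantity as the integrated error of the slices at fixed `a`. Since
the variables play interchangeable roles, both directions of the equivalence of flows follow. -/
theorem ae_tendsto_swap [SFinite μ] [SFinite ν] {g : ℕ → α → β → ℂ} {u : α → β → ℂ}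
    (hgm : ∀ k, AEStronglyMeasurable (Function.uncurry (g k)) (μ.prod ν))
    (hum : AEStronglyMeasurable (Function.uncurry u) (μ.prod ν))
    (hα : ∀ᵐ a ∂μ, IsOrthogonal ν (fun k => g k a))
    (hβ : ∀ᵐ b ∂ν, IsOrthogonal μ (fun k a => g k a b))
    (hs : ∑' k, ∫⁻ a, eLpNorm (g k a) 2 ν ^ 2 ∂μ ≠ ∞)
    (h : ∀ᵐ b ∂ν, Tendsto
      (fun N => eLpNorm (fun a => ∑ k ∈ Finset.range N, g k a b - u a b) 2 μ) atTop (𝓝 0)) :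
    ∀ᵐ a ∂μ, Tendsto (fun N => eLpNorm (fun b => ∑ k ∈ Finset.range N, g k a b - u a b) 2 ν)
      atTop (𝓝 0) := by
  have hm : ∀ N, AEStronglyMeasurable
      (fun z : α × β => ∑ k ∈ Finset.range N, g k z.1 z.2 - u z.1 z.2) (μ.prod ν) := fun N =>
    (Finset.aestronglyMeasurable_fun_sum (f := fun k (z : α × β) => g k z.1 z.2) _
      fun k _ => hgm k).sub hum
  have hswap : ∀ {F : α → β → ℂ}, AEStronglyMeasurable (Function.uncurry F) (μ.prod ν) →
      ∫⁻ a, eLpNorm (F a) 2 ν ^ 2 ∂μ = ∫⁻ b, eLpNorm (fun a => F a b) 2 μ ^ 2 ∂ν := by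
    intro F hF
    simp only [eLpNorm_two_sq]
    exact lintegral_lintegral_swap (f := fun a b => ‖F a b‖ₑ ^ 2) (hF.enorm.pow_const 2)
  refine ae_tendsto_of_tendsto_lintegral hm (hum.prodMk_left) hα ?_ ?_
  · rw [← lintegral_tsum] at hs
    · exact (ae_lt_top' (AEMeasurable.tsum fun k => by
        simp only [eLpNorm_two_sq]
        exact ((hgm k).enorm.pow_const 2).lintegral_prod_right') hs).mono fun _ h => h.ne
    · intro k
      simp only [eLpNorm_two_sq]
      exact ((hgm k).enorm.pow_const 2).lintegral_prod_right'
  · refine tendsto_of_tendsto_of_tendsto_of_le_of_le tendsto_const_nhds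
      (ENNReal.tendsto_sum_nat_add _ hs) (fun _ => zero_le) fun N => ?_
    dsimp only
    rw [hswap (F := fun a b => ∑ k ∈ Finset.range N, g k a b - u a b) (hm N)]
    simp_rw [fun k => hswap (hgm k)]
    rw [← lintegral_tsum]
    · refine lintegral_mono_ae ?_
      have hub : ∀ᵐ b ∂ν, AEStronglyMeasurable (fun a => u a b) μ :=
        AEStronglyMeasurable.prodMk_left (f := fun z : β × α => u z.2 z.1) hum.prod_swap
      filter_upwards [h, hβ, hub] with b hb hgb hub
      exact hgb.eLpNorm_sum_sub_limit_sq_le hub tendsto_id hb N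
    · intro k
      simp only [eLpNorm_two_sq]
      exact ((hgm (k + N)).prod_swap.enorm.pow_const 2).lintegral_prod_right'

theorem IsOrthogonal.const_mul {g : ι → α → ℂ} (hg : IsOrthogonal μ g) (c : ι → ℂ) :
    IsOrthogonal μ (fun i x => c i * g i x) where
  memLp i := (hg.memLp i).const_mul (c i)
  orthogonal i j hij := by
    simpa using hg.integral_star_sum_mul_sum (Finset.disjoint_singleton.mpr hij) c c

theorem IsOrthogonal.uncurry [SFinite μ] [SFinite ν] {g : ι → α → β → ℂ}
    (hg : ∀ᵐ a ∂μ, IsOrthogonal ν (fun k => g k a))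
    (hgm : ∀ k, MemLp (Function.uncurry (g k)) 2 (μ.prod ν)) :
    IsOrthogonal (μ.prod ν) (fun k => Function.uncurry (g k)) where
  memLp := hgm
  orthogonal j k hjk := by
    rw [integral_prod _ (integrable_star_mul (hgm j) (hgm k))]
    refine integral_eq_zero_of_ae ?_
    filter_upwards [hg] with a ha
    exact ha.orthogonal j k hjk

/-- Bessel's inequality for finite orthonormal sums. -/
theorem IsOrthogonal.eLpNorm_sum_coeff_le {g : ι → α → ℂ} (hg : IsOrthogonal μ g)
    (h1 : ∀ i, ∫ x, (starRingEnd ℂ) (g i x) * g i x ∂μ = 1) {f : α → ℂ} (hf : MemLp f 2 μ)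
    (s : Finset ι) :
    eLpNorm (fun x => ∑ i ∈ s, (∫ y, (starRingEnd ℂ) (g i y) * f y ∂μ) * g i x) 2 μ ≤
      eLpNorm f 2 μ := by
  classical
  set c : ι → ℂ := fun i => ∫ y, (starRingEnd ℂ) (g i y) * f y ∂μ
  set S : α → ℂ := fun x => ∑ i ∈ s, c i * g i x
  have hS : MemLp S 2 μ := memLp_finsetSum _ fun j _ => (hg.memLp j).const_mul _
  have hgS : ∀ i ∈ s, ∫ x, (starRingEnd ℂ) (g i x) * S x ∂μ = c i := by
    intro i hi
    simp only [S, Finset.mul_sum]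
    rw [integral_finsetSum _ fun j _ => integrable_star_mul (hg.memLp i)
      ((hg.memLp j).const_mul (c j)), Finset.sum_eq_single_of_mem i hi]
    · simp_rw [mul_left_comm _ (c i)]
      rw [integral_const_mul, h1, mul_one]
    · intro j _ hj
      simp_rw [mul_left_comm _ (c j)]
      rw [integral_const_mul, hg.orthogonal i j hj.symm, mul_zero]
  -- The remainder `f - S` is orthogonal to `S`, so Pythagoras for `f = S + (f - S)` gives the
  -- bound.
  have horth : ∫ x, (starRingEnd ℂ) (S x) * (f x - S x) ∂μ = 0 := by
    have e : ∀ x, (starRingEnd ℂ) (S x) * (f x - S x) =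
        ∑ i ∈ s, (starRingEnd ℂ) (c i) *
          ((starRingEnd ℂ) (g i x) * f x - (starRingEnd ℂ) (g i x) * S x) := by
      intro x
      conv_lhs => rw [show S x = ∑ i ∈ s, c i * g i x from rfl, map_sum, Finset.sum_mul]
      refine Finset.sum_congr rfl fun i _ => ?_
      rw [map_mul]
      ring
    simp_rw [e]
    rw [integral_finsetSum]
    · refine Finset.sum_eq_zero fun i hi => ?_
      rw [integral_const_mul, integral_sub (integrable_star_mul (hg.memLp i) hf)
        (integrable_star_mul (hg.memLp i) hS), hgS i hi, sub_self, mul_zero]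
    · exact fun i _ => ((integrable_star_mul (hg.memLp i) hf).sub
        (integrable_star_mul (hg.memLp i) hS)).const_mul _
  have key := eLpNorm_add_sq_of_orthogonal hS (hf.sub hS) horth
  have e : (fun x => S x + (f - S) x) = f := by ext x; simp
  rw [e] at key
  refine (ENNReal.pow_le_pow_left_iff two_ne_zero).mp ?_
  rw [key]
  exact le_self_add

end Orthogonal

/-! ### The two orthogonal expansions of the flow -/

section Flow

variable {n : ℕ}

instance : IsFiniteMeasure timeMeasure := by
  unfold timeMeasure
  infer_instance

theorem timeMeasure_univ : timeMeasure Set.univ = ENNReal.ofReal (2 * Real.pi) := by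
  simp [timeMeasure]

/-- The time factor `e^{-itℓ}`, `ℓ = 2k + n`. -/
noncomputable def phase (n k : ℕ) (t : ℝ) : ℂ :=
  Complex.exp (-(Complex.I * (t : ℂ) * ((2 * k + n : ℕ) : ℂ)))

theorem continuous_phase (n k : ℕ) : Continuous (phase n k) := by
  unfold phase
  fun_prop

theorem enorm_phase (n k : ℕ) (t : ℝ) : ‖phase n k t‖ₑ = 1 := by
  have : phase n k t = Complex.exp (((-(t * (2 * k + n : ℕ)) : ℝ) : ℂ) * Complex.I) := by
    unfold phase
    congr 1
    push_cast
    ring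
  rw [← ofReal_norm, this, Complex.norm_exp_ofReal_mul_I, ENNReal.ofReal_one]

theorem flowPartialSum_eq (f : EuclideanSpace ℝ (Fin n) → ℂ) (N : ℕ) (t : ℝ)
    (x : EuclideanSpace ℝ (Fin n)) :
    flowPartialSum f N t x = ∑ k ∈ Finset.range N, phase n k t * hermiteProj k f x := rfl

/-- The shift `n` cancels in `conj (phase n j) * phase n k`, leaving a nonzero integer frequency,
whose exponential integrates to zero over `[0, 2π]`. -/
theorem isOrthogonal_phase (n : ℕ) : IsOrthogonal timeMeasure (phase n) where
  memLp k := (memLp_top_of_bound (continuous_phase n k).aestronglyMeasurable 1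
    (ae_of_all _ fun t => by
      have := enorm_phase n k t
      rw [← ofReal_norm, ENNReal.ofReal_eq_one] at this
      exact this.le)).mono_exponent le_top
  orthogonal j k hjk := by
    set c : ℂ := Complex.I * ((2 * j : ℂ) - 2 * k) with hc
    have hjk' : ((j : ℂ) - k) ≠ 0 := sub_ne_zero.mpr (by exact_mod_cast hjk)
    have hc0 : c ≠ 0 := by
      rw [hc, ← mul_sub]
      exact mul_ne_zero Complex.I_ne_zero (mul_ne_zero two_ne_zero hjk')
    have e : ∀ t : ℝ, (starRingEnd ℂ) (phase n j t) * phase n k t = Complex.exp (c * t) := by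
      intro t
      rw [phase, phase, ← Complex.exp_conj, ← Complex.exp_add]
      congr 1
      simp [hc, show (starRingEnd ℂ) 2 = 2 from map_ofNat _ 2]
      ring
    simp_rw [e]
    rw [timeMeasure, integral_Icc_eq_integral_Ioc,
      ← intervalIntegral.integral_of_le (by positivity), integral_exp_mul_complex hc0]
    have : Complex.exp (c * ((2 * Real.pi : ℝ) : ℂ)) = 1 := by
      rw [Complex.exp_eq_one_iff]
      refine ⟨2 * j - 2 * k, ?_⟩
      push_cast
      rw [hc]
      ring
    rw [this]
    simp

theorem isOrthogonal_phase_mul (n : ℕ) (c : ℕ → ℂ) :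
    IsOrthogonal timeMeasure (fun k t => phase n k t * c k) := by
  simpa only [mul_comm] using (isOrthogonal_phase n).const_mul c

theorem eLpNorm_phase_mul_sq (n k : ℕ) (c : ℂ) :
    eLpNorm (fun t => phase n k t * c) 2 timeMeasure ^ 2 =
      ENNReal.ofReal (2 * Real.pi) * ‖c‖ₑ ^ 2 := by
  simp_rw [eLpNorm_two_sq, enorm_mul, enorm_phase, one_mul]
  rw [lintegral_const, timeMeasure_univ, mul_comm]

/-! ### Orthogonality of the eigenprojections in space -/

theorem continuous_hermiteProj (k : ℕ) (f : EuclideanSpace ℝ (Fin n) → ℂ) :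
    Continuous (hermiteProj k f) := by
  unfold hermiteProj
  exact continuous_finsetSum _ fun ν _ => continuous_const.mul
    (Complex.continuous_ofReal.comp (continuous_hermiteFun ν))

theorem isOrthogonal_hermiteFun :
    IsOrthogonal volume
      (fun (ν : Fin n → ℕ) (x : EuclideanSpace ℝ (Fin n)) => (hermiteFun ν x : ℂ)) where
  memLp := memLp_hermiteFun
  orthogonal ν μ h := by
    simp_rw [Complex.conj_ofReal, ← Complex.ofReal_mul]
    rw [integral_complex_ofReal, integral_hermiteFun_mul, if_neg h, Complex.ofReal_zero]

theorem disjoint_piAntidiag {j k : ℕ} (h : j ≠ k) :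
    Disjoint (Finset.piAntidiag (Finset.univ : Finset (Fin n)) j)
      (Finset.piAntidiag Finset.univ k) := by
  rw [Finset.disjoint_left]
  intro ν hj hk
  rw [Finset.mem_piAntidiag] at hj hk
  exact h (hj.1.symm.trans hk.1)

theorem isOrthogonal_hermiteProj (f : EuclideanSpace ℝ (Fin n) → ℂ) :
    IsOrthogonal volume (fun k => hermiteProj k f) where
  memLp k := memLp_finsetSum _ fun ν _ => (memLp_hermiteFun ν).const_mul _
  orthogonal j k h := by
    simp only [hermiteProj]
    exact isOrthogonal_hermiteFun.integral_star_sum_mul_sum (disjoint_piAntidiag h) _ _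

/-- Bessel's inequality for the eigenprojections. -/
theorem tsum_eLpNorm_hermiteProj_sq_le {f : EuclideanSpace ℝ (Fin n) → ℂ} (hf : MemLp f 2) :
    ∑' k, eLpNorm (hermiteProj k f) 2 ^ 2 ≤ eLpNorm f 2 ^ 2 := by
  refine ENNReal.tsum_le_of_sum_range_le fun N => ?_
  rw [← (isOrthogonal_hermiteProj f).eLpNorm_sum_sq]
  -- The levels `k < N` are disjoint, so the partial sum is one Bessel sum over their union; the
  -- `φ_ν` are real, so conjugation drops out.
  have h := isOrthogonal_hermiteFun.eLpNorm_sum_coeff_le (fun ν => by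
    simp_rw [Complex.conj_ofReal, ← Complex.ofReal_mul]
    rw [integral_complex_ofReal, integral_hermiteFun_mul, if_pos rfl, Complex.ofReal_one]) hf
    ((Finset.range N).biUnion (Finset.piAntidiag (Finset.univ : Finset (Fin n))))
  simp_rw [Finset.sum_biUnion fun j _ k _ hjk => disjoint_piAntidiag hjk,
    Complex.conj_ofReal, mul_comm ((hermiteFun _ _ : ℝ) : ℂ) (f _)] at h
  gcongr
  exact h

theorem aestronglyMeasurable_flow_term (f : EuclideanSpace ℝ (Fin n) → ℂ) (k : ℕ) :
    AEStronglyMeasurable (Function.uncurry fun t x => phase n k t * hermiteProj k f x)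
      (timeMeasure.prod volume) :=
  (((continuous_phase n k).comp continuous_fst).mul
    ((continuous_hermiteProj k f).comp continuous_snd)).aestronglyMeasurable

theorem isOrthogonal_flow_space (f : EuclideanSpace ℝ (Fin n) → ℂ) (t : ℝ) :
    IsOrthogonal volume (fun k x => phase n k t * hermiteProj k f x) :=
  (isOrthogonal_hermiteProj f).const_mul _

theorem eLpNorm_flow_term_sq (f : EuclideanSpace ℝ (Fin n) → ℂ) (k : ℕ) (t : ℝ) :
    eLpNorm (fun x => phase n k t * hermiteProj k f x) 2 volume ^ 2 =
      eLpNorm (hermiteProj k f) 2 volume ^ 2 := by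
  simp_rw [eLpNorm_two_sq, enorm_mul, enorm_phase, one_mul]

/-- The double sum needed by `ae_tendsto_swap` is `2π ∑ ‖P_ℓ f‖₂²`, finite by Bessel. -/
theorem isPointwiseFlow_iff_isL2Flow {f : EuclideanSpace ℝ (Fin n) → ℂ} (hf : MemLp f 2)
    {u : ℝ → EuclideanSpace ℝ (Fin n) → ℂ} : IsPointwiseFlow f u ↔ IsL2Flow f u := by
  have hB : ∑' k, eLpNorm (hermiteProj k f) 2 ^ 2 ≠ ∞ :=
    ne_top_of_le_ne_top (ENNReal.pow_ne_top hf.eLpNorm_ne_top) (tsum_eLpNorm_hermiteProj_sq_le hf)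
  constructor
  · rintro ⟨hm, ht⟩
    refine ⟨hf, hm, ?_⟩
    refine ae_tendsto_swap (g := fun k t x => phase n k t * hermiteProj k f x)
      (aestronglyMeasurable_flow_term f) hm (ae_of_all _ (isOrthogonal_flow_space f))
      (ae_of_all _ fun x => isOrthogonal_phase_mul n fun k => hermiteProj k f x) ?_ ht
    simp_rw [eLpNorm_flow_term_sq, lintegral_const, ENNReal.tsum_mul_right]
    exact ENNReal.mul_ne_top hB (measure_ne_top _ _)
  · rintro ⟨-, hm, ht⟩
    refine ⟨hm, ?_⟩
    refine ae_tendsto_swap (g := fun k x t => phase n k t * hermiteProj k f x)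
      (u := fun x t => u t x) (fun k => (aestronglyMeasurable_flow_term f k).prod_swap)
      hm.prod_swap (ae_of_all _ fun x => isOrthogonal_phase_mul n fun k => hermiteProj k f x)
      (ae_of_all _ (isOrthogonal_flow_space f)) ?_ ht
    simp_rw [eLpNorm_phase_mul_sq, lintegral_const_mul' _ _ ENNReal.ofReal_ne_top,
      ← eLpNorm_two_sq, ENNReal.tsum_mul_left]
    exact ENNReal.mul_ne_top ENNReal.ofReal_ne_top hB

/-- The square function is only finite almost everywhere, so the series need not converge in `L²` of
the product. A weight in `x` makes it converge there, which yields a jointly measurable limit;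
dividing by the weight on each slice recovers the flow. -/
theorem exists_isPointwiseFlow {f : EuclideanSpace ℝ (Fin n) → ℂ}
    (hA : ∀ᵐ x, ∑' k, ‖hermiteProj k f x‖ₑ ^ 2 ≠ ∞) :
    ∃ u : ℝ → EuclideanSpace ℝ (Fin n) → ℂ, IsPointwiseFlow f u := by
  obtain ⟨w, hw0, hwm, hw1⟩ := exists_pos_lintegral_lt_of_sigmaFinite
    (volume : Measure (EuclideanSpace ℝ (Fin n))) one_ne_zero
  set A : EuclideanSpace ℝ (Fin n) → ℝ≥0∞ := fun x => ∑' k, ‖hermiteProj k f x‖ₑ ^ 2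
  have hAm : Measurable A := Measurable.tsum fun k =>
    (continuous_hermiteProj k f).measurable.enorm.pow_const 2
  -- Chosen so that `W² A ≤ w` is integrable while `W > 0` wherever `A` is finite; the `1 +` guards
  -- against `A x = 0`.
  set W : EuclideanSpace ℝ (Fin n) → ℝ≥0∞ := fun x => (w x / (1 + A x)) ^ (1 / 2 : ℝ)
  have hWm : Measurable W :=
    ((hwm.coe_nnreal_ennreal.div (measurable_const.add hAm))).pow_const _
  have hWtop : ∀ x, W x ≠ ∞ := fun x => ENNReal.rpow_ne_top_of_nonneg (by norm_num)
    (ENNReal.div_ne_top ENNReal.coe_ne_top (by simp))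
  have hWA : ∀ x, W x ^ 2 * A x ≤ w x := by
    intro x
    rw [rpow_half_sq, mul_comm, ← mul_div_assoc]
    refine ENNReal.div_le_of_le_mul ?_
    rw [mul_comm]
    gcongr
    exact le_add_self
  set h : EuclideanSpace ℝ (Fin n) → ℂ := fun x => ((W x).toReal : ℂ)
  have hhm : Measurable h := Complex.measurable_ofReal.comp hWm.ennreal_toReal
  have hhe : ∀ x, ‖h x‖ₑ = W x := by
    intro x
    rw [← ofReal_norm, Complex.norm_real, Real.norm_of_nonneg ENNReal.toReal_nonneg,
      ENNReal.ofReal_toReal (hWtop x)]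
  set g : ℕ → EuclideanSpace ℝ (Fin n) → ℝ → ℂ :=
    fun k x t => phase n k t * (h x * hermiteProj k f x)
  have hgm : ∀ k, AEStronglyMeasurable (Function.uncurry (g k)) (volume.prod timeMeasure) := by
    intro k
    refine Measurable.aestronglyMeasurable ?_
    exact ((continuous_phase n k).measurable.comp measurable_snd).mul
      ((hhm.comp measurable_fst).mul ((continuous_hermiteProj k f).measurable.comp measurable_fst))
  have hgo : ∀ x, IsOrthogonal timeMeasure (fun k => g k x) := fun x =>
    isOrthogonal_phase_mul n _
  have hgs : ∀ x, ∑' k, eLpNorm (g k x) 2 timeMeasure ^ 2 ≤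
      ENNReal.ofReal (2 * Real.pi) * w x := by
    intro x
    simp only [g, eLpNorm_phase_mul_sq]
    rw [ENNReal.tsum_mul_left]
    gcongr
    simp_rw [enorm_mul, mul_pow]
    rw [ENNReal.tsum_mul_left, hhe]
    exact hWA x
  have hprod : ∀ {F : EuclideanSpace ℝ (Fin n) → ℝ → ℂ},
      AEStronglyMeasurable (Function.uncurry F) (volume.prod timeMeasure) →
      eLpNorm (Function.uncurry F) 2 (volume.prod timeMeasure) ^ 2 =
        ∫⁻ x, eLpNorm (F x) 2 timeMeasure ^ 2 := by
    intro F hF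
    simp only [eLpNorm_two_sq]
    rw [lintegral_prod _ (hF.enorm.pow_const 2)]
    rfl
  have hsum : ∑' k, eLpNorm (Function.uncurry (g k)) 2 (volume.prod timeMeasure) ^ 2 ≠ ∞ := by
    simp_rw [fun k => hprod (hgm k)]
    rw [← lintegral_tsum]
    · refine ne_top_of_le_ne_top ?_ (lintegral_mono hgs)
      rw [lintegral_const_mul' _ _ ENNReal.ofReal_ne_top]
      exact ENNReal.mul_ne_top ENNReal.ofReal_ne_top (hw1.trans ENNReal.one_lt_top).ne
    · intro k
      simp only [eLpNorm_two_sq]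
      exact ((hgm k).enorm.pow_const 2).lintegral_prod_right'
  have hgO : IsOrthogonal (volume.prod timeMeasure) (fun k => Function.uncurry (g k)) := by
    refine IsOrthogonal.uncurry (ae_of_all _ hgo) fun k => ⟨hgm k, ?_⟩
    have := ne_top_of_le_ne_top hsum (ENNReal.le_tsum k)
    exact lt_top_iff_ne_top.mpr fun h => this (by simp [h])
  obtain ⟨v, hv, hvt⟩ := hgO.exists_limit hsum
  have hvm : AEStronglyMeasurable (Function.uncurry fun x t => v (x, t))
      (volume.prod timeMeasure) := hv.1
  have hsubm : ∀ N, AEStronglyMeasurable (Function.uncurry fun x t =>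
      ∑ k ∈ Finset.range N, g k x t - v (x, t)) (volume.prod timeMeasure) := fun N =>
    (Finset.aestronglyMeasurable_fun_sum (f := fun k => Function.uncurry (g k)) _
      fun k _ => hgm k).sub hvm
  have hlim := ae_tendsto_of_tendsto_lintegral (g := g) (u := fun x t => v (x, t)) hsubm
    hvm.prodMk_left (ae_of_all _ hgo)
    (ae_of_all _ fun x => ne_top_of_le_ne_top
      (ENNReal.mul_ne_top ENNReal.ofReal_ne_top ENNReal.coe_ne_top) (hgs x)) (by
      simp_rw [← fun N => hprod (hsubm N)]
      have := ((ENNReal.continuous_pow 2).tendsto 0).comp hvt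
      rw [zero_pow two_ne_zero] at this
      exact this)
  refine ⟨fun t x => (h x)⁻¹ * v (x, t), ?_, ?_⟩
  · exact ((hhm.inv.comp measurable_snd).aestronglyMeasurable).mul hv.1.prod_swap
  · filter_upwards [hlim, hA] with x hx hAx
    have hW0 : W x ≠ 0 := by
      refine (ENNReal.rpow_pos (ENNReal.div_pos ?_ ?_) ?_).ne'
      · exact_mod_cast (hw0 x).ne'
      · exact ENNReal.add_ne_top.mpr ⟨ENNReal.one_ne_top, hAx⟩
      · exact ENNReal.div_ne_top ENNReal.coe_ne_top (by simp)
    have hh0 : h x ≠ 0 := by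
      rw [← enorm_ne_zero, hhe]
      exact hW0
    have e : ∀ N, eLpNorm (fun t => flowPartialSum f N t x - (h x)⁻¹ * v (x, t)) 2 timeMeasure =
        ‖(h x)⁻¹‖ₑ * eLpNorm (fun t => ∑ k ∈ Finset.range N, g k x t - v (x, t)) 2
          timeMeasure := by
      intro N
      rw [← eLpNorm_const_smul]
      congr 1
      ext t
      simp only [flowPartialSum_eq, g, Pi.smul_apply, smul_eq_mul, mul_sub, Finset.mul_sum]
      congr 1
      refine Finset.sum_congr rfl fun k _ => ?_
      field_simp
    simp_rw [e]
    have := ENNReal.Tendsto.const_mul hx (Or.inr (enorm_ne_top (x := (h x)⁻¹)))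
    simpa using this

end Flow

/-! ### The Sobolev embedding `H^{1/2-1/q} ⊆ L^q` in the time variable -/

section Sobolev

/-- Bernoulli's inequality for `(1 - 1/(N+1))^a` is the induction step `a (N+1)^{a-1} ≤ (N+1)^a -
N^a`. -/
theorem sum_range_rpow_sub_one_le {a : ℝ} (ha0 : 0 < a) (ha1 : a ≤ 1) (N : ℕ) :
    ∑ k ∈ Finset.range N, ((k : ℝ) + 1) ^ (a - 1) ≤ (N : ℝ) ^ a / a := by
  induction N with
  | zero => simp [Real.zero_rpow ha0.ne']
  | succ N ih =>
    rw [Finset.sum_range_succ]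
    have hN : (0 : ℝ) < N + 1 := by positivity
    have h1 : (1 + -(1 / ((N : ℝ) + 1))) ^ a ≤ 1 + a * -(1 / ((N : ℝ) + 1)) := by
      refine rpow_one_add_le_one_add_mul_self ?_ ha0.le ha1
      rw [neg_le_neg_iff, div_le_one hN]
      linarith [(N.cast_nonneg : (0 : ℝ) ≤ N)]
    have h2 : (1 + -(1 / ((N : ℝ) + 1))) = N / (N + 1) := by field_simp; ring
    rw [h2, Real.div_rpow N.cast_nonneg hN.le, div_le_iff₀ (by positivity)] at h1
    have h3 : ((N : ℝ) + 1) ^ (a - 1) = (N + 1) ^ a / (N + 1) := by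
      rw [Real.rpow_sub_one hN.ne']
    push_cast
    calc _ ≤ (N : ℝ) ^ a / a + (N + 1) ^ (a - 1) := by gcongr
      _ ≤ (1 + a * -(1 / ((N : ℝ) + 1))) * (N + 1) ^ a / a + (N + 1) ^ (a - 1) := by gcongr
      _ = ((N : ℝ) + 1) ^ a / a := by rw [h3]; field_simp; ring

/-- Cauchy–Schwarz with the weights `(k+1)^{±(1-a)/2}`; this is the uniform bound on the low
frequencies. -/
theorem sq_sum_range_norm_le {a M : ℝ} (ha0 : 0 < a) (ha1 : a ≤ 1) {c : ℕ → ℂ}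
    (hc : ∀ N, ∑ k ∈ Finset.range N, ((k : ℝ) + 1) ^ (1 - a) * ‖c k‖ ^ 2 ≤ M ^ 2) (N : ℕ) :
    (∑ k ∈ Finset.range N, ‖c k‖) ^ 2 ≤ M ^ 2 * ((N : ℝ) ^ a / a) := by
  have h := Finset.sum_mul_sq_le_sq_mul_sq (Finset.range N)
    (fun k => ((k : ℝ) + 1) ^ ((1 - a) / 2) * ‖c k‖) (fun k => ((k : ℝ) + 1) ^ ((a - 1) / 2))
  have hk : ∀ k : ℕ, (0 : ℝ) < k + 1 := fun k => by positivity
  have e1 : ∀ k : ℕ, ((k : ℝ) + 1) ^ ((1 - a) / 2) * ‖c k‖ * ((k : ℝ) + 1) ^ ((a - 1) / 2) =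
      ‖c k‖ := by
    intro k
    rw [mul_right_comm, ← Real.rpow_add (hk k)]
    ring_nf
    simp
  have e2 : ∀ k : ℕ, (((k : ℝ) + 1) ^ ((1 - a) / 2) * ‖c k‖) ^ 2 =
      ((k : ℝ) + 1) ^ (1 - a) * ‖c k‖ ^ 2 := by
    intro k
    rw [mul_pow, ← Real.rpow_mul_natCast (hk k).le]
    norm_num
  have e3 : ∀ k : ℕ, (((k : ℝ) + 1) ^ ((a - 1) / 2)) ^ 2 = ((k : ℝ) + 1) ^ (a - 1) := by
    intro k
    rw [← Real.rpow_mul_natCast (hk k).le]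
    norm_num
  simp_rw [e1, e2, e3] at h
  exact h.trans (mul_le_mul (hc N) (sum_range_rpow_sub_one_le ha0 ha1 N)
    (Finset.sum_nonneg fun k _ => by positivity) (sq_nonneg M))

theorem lintegral_Ioo_rpow {q R : ℝ} (hq : 2 < q) (hR : 0 ≤ R) :
    ∫⁻ l in Set.Ioo 0 R, ENNReal.ofReal (l ^ (q - 3)) =
      ENNReal.ofReal (R ^ (q - 2) / (q - 2)) := by
  have hi : IntegrableOn (fun l : ℝ => l ^ (q - 3)) (Set.Ioc 0 R) :=
    (intervalIntegrable_iff_integrableOn_Ioc_of_le hR).mp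
      (intervalIntegral.intervalIntegrable_rpow' (by linarith))
  rw [setLIntegral_congr Ioo_ae_eq_Ioc, ← ofReal_integral_eq_lintegral_ofReal hi]
  · rw [← intervalIntegral.integral_of_le hR, integral_rpow (Or.inl (by linarith))]
    rw [Real.zero_rpow (by linarith)]
    congr 1
    ring_nf
  · filter_upwards [ae_restrict_mem measurableSet_Ioc] with l hl
    exact Real.rpow_nonneg hl.1.le _

variable {n : ℕ} {c : ℕ → ℂ} {u : ℝ → ℂ}

/-- The weak-type estimate at height `l`: the low frequencies contribute at most `l / 2`
pointwise, the high ones are estimated in `L²`. -/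
theorem timeMeasure_lt_norm_le (hu : AEStronglyMeasurable u timeMeasure)
    (h : Tendsto (fun N => eLpNorm (fun t => ∑ k ∈ Finset.range N, phase n k t * c k - u t) 2
      timeMeasure) atTop (𝓝 0)) {l : ℝ} (hl : 0 < l) {N : ℕ}
    (hN : (∑ k ∈ Finset.range N, ‖c k‖) ^ 2 ≤ l ^ 2 / 4) :
    timeMeasure {t | l < ‖u t‖} ≤
      ENNReal.ofReal (4 / l ^ 2) * (ENNReal.ofReal (2 * Real.pi) * ∑' k, ‖c (k + N)‖ₑ ^ 2) := by
  have hS : ∑ k ∈ Finset.range N, ‖c k‖ ≤ l / 2 := by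
    refine (pow_le_pow_iff_left₀ (Finset.sum_nonneg fun k _ => norm_nonneg _) (by positivity)
      two_ne_zero).mp ?_
    rw [div_pow]
    norm_num
    exact hN
  have hl2 : (0 : ℝ) < l ^ 2 / 4 := by positivity
  have hsub : {t | l < ‖u t‖} ⊆ {t | ENNReal.ofReal (l ^ 2 / 4) ≤
      ‖∑ k ∈ Finset.range N, phase n k t * c k - u t‖ₑ ^ 2} := by
    intro t ht
    have h1 : ‖∑ k ∈ Finset.range N, phase n k t * c k‖ ≤ l / 2 := by
      refine (norm_sum_le _ _).trans (le_trans (le_of_eq ?_) hS)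
      refine Finset.sum_congr rfl fun k _ => ?_
      have := enorm_phase n k t
      rw [← ofReal_norm, ENNReal.ofReal_eq_one] at this
      rw [norm_mul, this, one_mul]
    have h2 : l / 2 ≤ ‖∑ k ∈ Finset.range N, phase n k t * c k - u t‖ := by
      have := norm_sub_norm_le (u t) (∑ k ∈ Finset.range N, phase n k t * c k)
      rw [norm_sub_rev] at this
      have ht' : l < ‖u t‖ := ht
      linarith
    rw [Set.mem_ofPred_eq, ← ofReal_norm, ← ENNReal.ofReal_pow (norm_nonneg _)]
    refine ENNReal.ofReal_le_ofReal ?_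
    calc l ^ 2 / 4 = (l / 2) ^ 2 := by ring
      _ ≤ _ := by gcongr
  have hm : AEStronglyMeasurable (fun t => ∑ k ∈ Finset.range N, phase n k t * c k - u t)
      timeMeasure :=
    (memLp_finsetSum _ fun k _ => (isOrthogonal_phase_mul n c).memLp k).1.sub hu
  calc timeMeasure {t | l < ‖u t‖}
      ≤ _ := measure_mono hsub
    _ ≤ _ := meas_ge_le_lintegral_div (hm.enorm.pow_const 2)
        (ENNReal.ofReal_pos.mpr hl2).ne' ENNReal.ofReal_ne_top
    _ = ENNReal.ofReal (4 / l ^ 2) *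
        eLpNorm (fun t => ∑ k ∈ Finset.range N, phase n k t * c k - u t) 2 timeMeasure ^ 2 := by
      rw [eLpNorm_two_sq, ENNReal.div_eq_inv_mul, ← ENNReal.ofReal_inv_of_pos hl2, inv_div]
    _ ≤ _ := by
      gcongr
      refine ((isOrthogonal_phase_mul n c).eLpNorm_sum_sub_limit_sq_le hu tendsto_id h N).trans ?_
      simp_rw [eLpNorm_phase_mul_sq]
      rw [ENNReal.tsum_mul_left]

/-- Layer cake formula, with the weak-type estimate at each height `l` and a cutoff adapted to `l`.
Frequency `k` lies in the tail only for `l < R k`, and after Tonelli the integral of `l^{q-3}` up to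
`R k` reproduces exactly the Sobolev weight `(k+1)^{1-2/q}`. -/
theorem lintegral_enorm_rpow_le {q : ℝ} (hq : 2 < q) (hu : AEStronglyMeasurable u timeMeasure)
    (h : Tendsto (fun N => eLpNorm (fun t => ∑ k ∈ Finset.range N, phase n k t * c k - u t) 2
      timeMeasure) atTop (𝓝 0)) {M : ℝ} (hM : 0 < M)
    (hc : ∑' k : ℕ, ENNReal.ofReal (((k : ℝ) + 1) ^ (1 - 2 / q)) * ‖c k‖ₑ ^ 2 ≤
      ENNReal.ofReal (M ^ 2)) :
    ∫⁻ t, ‖u t‖ₑ ^ q ∂timeMeasure ≤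
      ENNReal.ofReal (q * (8 * Real.pi) * ((2 / √(2 / q)) ^ (q - 2) / (q - 2)) * M ^ q) := by
  have hq0 : 0 < q := by linarith
  have hq2 : 0 < q - 2 := by linarith
  obtain ⟨a, ha⟩ : ∃ a, a = 2 / q := ⟨_, rfl⟩
  rw [← ha] at hc ⊢
  have ha0 : 0 < a := by rw [ha]; positivity
  have ha1 : a ≤ 1 := by rw [ha, div_le_one hq0]; exact hq.le
  have hcN : ∀ N, ∑ k ∈ Finset.range N, ((k : ℝ) + 1) ^ (1 - a) * ‖c k‖ ^ 2 ≤ M ^ 2 := by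
    intro N
    rw [← ENNReal.ofReal_le_ofReal_iff (sq_nonneg M),
      ENNReal.ofReal_sum_of_nonneg fun k _ => by positivity]
    refine le_trans ?_ ((ENNReal.sum_le_tsum (Finset.range N)).trans hc)
    refine Finset.sum_le_sum fun k _ => ?_
    rw [ENNReal.ofReal_mul (by positivity), ENNReal.ofReal_pow (norm_nonneg _), ofReal_norm]
  -- The solution `l` of `M² (k+1)^a / a = l² / 4`.
  set R : ℕ → ℝ := fun k => 2 / √a * M * ((k : ℝ) + 1) ^ (a / 2)
  have hR : ∀ k, 0 ≤ R k := fun k => by positivity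
  have hRq : ∀ k, R k ^ (q - 2) / (q - 2) =
      ((2 / √a) ^ (q - 2) / (q - 2)) * M ^ (q - 2) * ((k : ℝ) + 1) ^ (1 - a) := by
    intro k
    have hk : (0 : ℝ) ≤ (k : ℝ) + 1 := by positivity
    have e : a / 2 * (q - 2) = 1 - a := by rw [ha]; field_simp
    simp only [R]
    rw [Real.mul_rpow (by positivity) (by positivity), Real.mul_rpow (by positivity) hM.le,
      ← Real.rpow_mul hk, e]
    ring
  have hlevel : ∀ l : ℝ, 0 < l → timeMeasure {t | l < ‖u t‖} * ENNReal.ofReal (l ^ (q - 1)) ≤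
      ∑' k, ENNReal.ofReal (8 * Real.pi) * ‖c k‖ₑ ^ 2 *
        (Set.Iio (R k)).indicator (fun l => ENNReal.ofReal (l ^ (q - 3))) l := by
    intro l hl
    -- The largest real cutoff for which Cauchy–Schwarz keeps the low frequencies below `l / 2`.
    set y : ℝ := (l ^ 2 * a / (4 * M ^ 2)) ^ (1 / a)
    have hy0 : 0 ≤ y := by positivity
    have hya : y ^ a = l ^ 2 * a / (4 * M ^ 2) := by
      rw [← Real.rpow_mul (by positivity), one_div_mul_cancel ha0.ne', Real.rpow_one]
    set N := ⌊y⌋₊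
    have hN : (∑ k ∈ Finset.range N, ‖c k‖) ^ 2 ≤ l ^ 2 / 4 := by
      refine (sq_sum_range_norm_le ha0 ha1 hcN N).trans ?_
      have : (N : ℝ) ^ a ≤ y ^ a := Real.rpow_le_rpow N.cast_nonneg (Nat.floor_le hy0) ha0.le
      calc M ^ 2 * ((N : ℝ) ^ a / a) ≤ M ^ 2 * (y ^ a / a) := by gcongr
        _ = l ^ 2 / 4 := by rw [hya]; field_simp
    -- From `y < N + 1`: every tail frequency satisfies `l < R`, so the indicator can be inserted
    -- without loss and the sum then extended to all `k`.
    have hlR : ∀ k, l < R (k + N) := by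
      intro k
      have h1 : y < ((k + N : ℕ) : ℝ) + 1 := by
        refine (Nat.lt_floor_add_one y).trans_le ?_
        push_cast
        linarith [(k.cast_nonneg : (0 : ℝ) ≤ k)]
      have h2 : y ^ a < (((k + N : ℕ) : ℝ) + 1) ^ a := Real.rpow_lt_rpow hy0 h1 ha0
      refine (pow_lt_pow_iff_left₀ hl.le (hR _) two_ne_zero).mp ?_
      simp only [R]
      rw [mul_pow, mul_pow, div_pow, Real.sq_sqrt ha0.le, ← Real.rpow_mul_natCast (by positivity)]
      rw [hya, div_lt_iff₀ (by positivity)] at h2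
      rw [div_mul_eq_mul_div, div_mul_eq_mul_div, lt_div_iff₀ ha0]
      have e : a / 2 * ((2 : ℕ) : ℝ) = a := by push_cast; ring
      rw [e]
      linarith
    have hl3 : 4 / l ^ 2 * l ^ (q - 1) = 4 * l ^ (q - 3) := by
      have : l ^ (q - 1) = l ^ (q - 3) * l ^ 2 := by
        rw [← Real.rpow_natCast, ← Real.rpow_add hl]
        congr 1
        push_cast
        ring
      rw [this]
      field_simp
    have hD : ENNReal.ofReal (4 / l ^ 2) * ENNReal.ofReal (2 * Real.pi) *
        ENNReal.ofReal (l ^ (q - 1)) =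
        ENNReal.ofReal (8 * Real.pi) * ENNReal.ofReal (l ^ (q - 3)) := by
      rw [← ENNReal.ofReal_mul (by positivity), ← ENNReal.ofReal_mul (by positivity),
        ← ENNReal.ofReal_mul (by positivity)]
      congr 1
      linear_combination 2 * Real.pi * hl3
    calc timeMeasure {t | l < ‖u t‖} * ENNReal.ofReal (l ^ (q - 1))
        ≤ ENNReal.ofReal (4 / l ^ 2) * (ENNReal.ofReal (2 * Real.pi) * ∑' k, ‖c (k + N)‖ₑ ^ 2) *
          ENNReal.ofReal (l ^ (q - 1)) := by
          gcongr
          exact timeMeasure_lt_norm_le hu h hl hN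
      _ = ∑' k, ENNReal.ofReal (8 * Real.pi) * ‖c (k + N)‖ₑ ^ 2 *
          ENNReal.ofReal (l ^ (q - 3)) := by
          rw [ENNReal.tsum_mul_right, ENNReal.tsum_mul_left, mul_right_comm (ENNReal.ofReal (8 * Real.pi)), ← hD]
          ring
      _ = ∑' k, ENNReal.ofReal (8 * Real.pi) * ‖c (k + N)‖ₑ ^ 2 *
          (Set.Iio (R (k + N))).indicator (fun l => ENNReal.ofReal (l ^ (q - 3))) l := by
          congr 1
          ext k
          rw [Set.indicator_of_mem (Set.mem_Iio.mpr (hlR k))]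
      _ ≤ _ := ENNReal.tsum_comp_le_tsum_of_injective (add_left_injective N) (fun k =>
          ENNReal.ofReal (8 * Real.pi) * ‖c k‖ₑ ^ 2 *
            (Set.Iio (R k)).indicator (fun l => ENNReal.ofReal (l ^ (q - 3))) l)
  have hmeas : Measurable fun l : ℝ => ENNReal.ofReal (l ^ (q - 3)) := by fun_prop
  have hint : ∀ k, ∫⁻ l in Set.Ioi 0, ENNReal.ofReal (8 * Real.pi) * ‖c k‖ₑ ^ 2 *
        (Set.Iio (R k)).indicator (fun l => ENNReal.ofReal (l ^ (q - 3))) l =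
      ENNReal.ofReal (8 * Real.pi * ((2 / √a) ^ (q - 2) / (q - 2) * M ^ (q - 2))) *
        (ENNReal.ofReal (((k : ℝ) + 1) ^ (1 - a)) * ‖c k‖ₑ ^ 2) := by
    intro k
    rw [lintegral_const_mul _ (hmeas.indicator measurableSet_Iio),
      lintegral_indicator measurableSet_Iio, Measure.restrict_restrict measurableSet_Iio,
      Set.inter_comm, Set.Ioi_inter_Iio, lintegral_Ioo_rpow hq (hR k), hRq,
      ENNReal.ofReal_mul (q := ((k : ℝ) + 1) ^ (1 - a)) (by positivity),
      ENNReal.ofReal_mul (p := 8 * Real.pi) (by positivity)]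
    ring
  calc ∫⁻ t, ‖u t‖ₑ ^ q ∂timeMeasure
      = ∫⁻ t, ENNReal.ofReal (‖u t‖ ^ q) ∂timeMeasure := by
        refine lintegral_congr fun t => ?_
        rw [← ofReal_norm, ENNReal.ofReal_rpow_of_nonneg (norm_nonneg _) hq0.le]
    _ = ENNReal.ofReal q * ∫⁻ l in Set.Ioi 0, timeMeasure {t | l < ‖u t‖} *
          ENNReal.ofReal (l ^ (q - 1)) :=
        lintegral_rpow_eq_lintegral_meas_lt_mul timeMeasure
          (ae_of_all _ fun t => norm_nonneg (u t)) hu.norm.aemeasurable hq0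
    _ ≤ ENNReal.ofReal q * ∫⁻ l in Set.Ioi 0, ∑' k, ENNReal.ofReal (8 * Real.pi) * ‖c k‖ₑ ^ 2 *
        (Set.Iio (R k)).indicator (fun l => ENNReal.ofReal (l ^ (q - 3))) l := by
        exact mul_le_mul' le_rfl (setLIntegral_mono' measurableSet_Ioi hlevel)
    _ = ENNReal.ofReal q *
        (ENNReal.ofReal (8 * Real.pi * ((2 / √a) ^ (q - 2) / (q - 2) * M ^ (q - 2))) *
        ∑' k : ℕ, ENNReal.ofReal (((k : ℝ) + 1) ^ (1 - a)) * ‖c k‖ₑ ^ 2) := by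
        rw [lintegral_tsum fun k =>
          ((hmeas.indicator measurableSet_Iio).const_mul _).aemeasurable]
        simp_rw [hint]
        rw [ENNReal.tsum_mul_left]
    _ ≤ ENNReal.ofReal q *
        (ENNReal.ofReal (8 * Real.pi * ((2 / √a) ^ (q - 2) / (q - 2) * M ^ (q - 2))) *
        ENNReal.ofReal (M ^ 2)) := by gcongr
    _ = _ := by
        rw [← ENNReal.ofReal_mul (by positivity), ← ENNReal.ofReal_mul hq0.le]
        congr 1
        have : M ^ q = M ^ (q - 2) * M ^ 2 := by
          rw [← Real.rpow_natCast, ← Real.rpow_add hM]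
          congr 1
          push_cast
          ring
        rw [this]
        ring

/-- The endpoint Sobolev embedding for the series `∑ e^{-itℓ} c_k`, `ℓ = 2k + n`. -/
theorem exists_eLpNorm_le_of_phase_series (n : ℕ) {q : ℝ} (hq : 2 ≤ q) :
    ∃ C : ℝ≥0, 0 < C ∧ ∀ (c : ℕ → ℂ) (u : ℝ → ℂ), AEStronglyMeasurable u timeMeasure →
      Tendsto (fun N => eLpNorm (fun t => ∑ k ∈ Finset.range N, phase n k t * c k - u t) 2
        timeMeasure) atTop (𝓝 0) →
      eLpNorm u (ENNReal.ofReal q) timeMeasure ≤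
        C * (∑' k : ℕ, ENNReal.ofReal (((k : ℝ) + 1) ^ (1 - 2 / q)) * ‖c k‖ₑ ^ 2) ^
          (1 / 2 : ℝ) := by
  rcases hq.eq_or_lt with rfl | hq
  -- At `q = 2` the factor `1 / (q - 2)` is unavailable; the tail bound with `N = 0` suffices.
  · refine ⟨(2 * Real.pi).toNNReal ^ (1 / 2 : ℝ), NNReal.rpow_pos (by positivity), ?_⟩
    intro c u hu h
    have h1 := (isOrthogonal_phase_mul n c).eLpNorm_sum_sub_limit_sq_le hu tendsto_id h 0
    simp_rw [eLpNorm_phase_mul_sq] at h1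
    rw [ENNReal.tsum_mul_left] at h1
    simp only [Finset.range_zero, Finset.sum_empty, zero_sub, add_zero] at h1
    rw [show (fun t => -u t) = -u from rfl, eLpNorm_neg] at h1
    have h2 := le_rpow_half_of_sq_le h1
    rw [ENNReal.mul_rpow_of_nonneg _ _ (by norm_num)] at h2
    rw [ENNReal.coe_rpow_of_nonneg _ (by norm_num)]
    have e : (1 - 2 / 2 : ℝ) = 0 := by norm_num
    simp only [e, Real.rpow_zero, ENNReal.ofReal_one, one_mul, ENNReal.ofReal_ofNat]
    exact h2
  · have hq0 : 0 < q := by linarith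
    have hq2 : 0 < q - 2 := by linarith
    set C₀ : ℝ := q * (8 * Real.pi) * ((2 / √(2 / q)) ^ (q - 2) / (q - 2))
    have hC₀ : 0 < C₀ := by positivity
    set C : ℝ := C₀ ^ (1 / q)
    have hC : 0 < C := by positivity
    refine ⟨C.toNNReal, Real.toNNReal_pos.mpr hC, ?_⟩
    intro c u hu h
    set T := ∑' k : ℕ, ENNReal.ofReal (((k : ℝ) + 1) ^ (1 - 2 / q)) * ‖c k‖ₑ ^ 2
    have key : ∀ M : ℝ, 0 < M → T ^ (1 / 2 : ℝ) ≤ ENNReal.ofReal M →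
        eLpNorm u (ENNReal.ofReal q) timeMeasure ≤ ENNReal.ofReal C * ENNReal.ofReal M := by
      intro M hM hTM
      have hT : T ≤ ENNReal.ofReal (M ^ 2) := by
        rw [ENNReal.ofReal_pow hM.le, ← rpow_half_sq T]
        gcongr
      have h1 := lintegral_enorm_rpow_le hq hu h hM hT
      rw [eLpNorm_eq_lintegral_rpow_enorm_toReal (by simpa using hq0) ENNReal.ofReal_ne_top,
        ENNReal.toReal_ofReal hq0.le]
      calc (∫⁻ t, ‖u t‖ₑ ^ q ∂timeMeasure) ^ (1 / q)
          ≤ (ENNReal.ofReal (C₀ * M ^ q)) ^ (1 / q) := by gcongr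
        _ = ENNReal.ofReal C * ENNReal.ofReal M := by
          rw [ENNReal.ofReal_rpow_of_nonneg (by positivity) (by positivity),
            Real.mul_rpow hC₀.le (by positivity), ← Real.rpow_mul hM.le,
            mul_one_div_cancel hq0.ne', Real.rpow_one, ENNReal.ofReal_mul hC.le]
    change _ ≤ ENNReal.ofReal C * _
    by_cases hT : T ^ (1 / 2 : ℝ) = ∞
    · rw [hT, ENNReal.mul_top (ENNReal.ofReal_pos.mpr hC).ne']
      exact le_top
    -- `key` needs a strictly positive `M`, so `ε / C` is added to cover `T = 0`.
    · refine ENNReal.le_of_forall_pos_le_add fun ε hε _ => ?_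
      have hM : 0 < (T ^ (1 / 2 : ℝ)).toReal + ε / C :=
        add_pos_of_nonneg_of_pos ENNReal.toReal_nonneg (by positivity)
      refine (key _ hM ?_).trans (le_of_eq ?_)
      · refine (ENNReal.ofReal_toReal hT).ge.trans (ENNReal.ofReal_le_ofReal ?_)
        exact le_add_of_nonneg_right (by positivity)
      · rw [ENNReal.ofReal_add ENNReal.toReal_nonneg (by positivity), ENNReal.ofReal_toReal hT,
          mul_add, ← ENNReal.ofReal_mul hC.le, mul_div_cancel₀ _ hC.ne', ENNReal.ofReal_coe_nnreal]

end Sobolev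

/-! ### The mixed norm estimates -/

section MixedNorm

variable {n : ℕ} {f : EuclideanSpace ℝ (Fin n) → ℂ} {u : ℝ → EuclideanSpace ℝ (Fin n) → ℂ}

theorem IsPointwiseFlow.of_or (h : IsPointwiseFlow f u ∨ IsL2Flow f u) : IsPointwiseFlow f u :=
  h.elim id fun h => (isPointwiseFlow_iff_isL2Flow h.memLp).mpr h

theorem IsPointwiseFlow.ae_aestronglyMeasurable (h : IsPointwiseFlow f u) :
    ∀ᵐ x, AEStronglyMeasurable (fun t => u t x) timeMeasure :=
  AEStronglyMeasurable.prodMk_left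
    (f := fun z : EuclideanSpace ℝ (Fin n) × ℝ => u z.2 z.1) h.measurable.prod_swap

theorem ae_lt_top_of_eLpNorm_lt_top {α : Type*} [MeasurableSpace α] {μ : Measure α}
    {F : α → ℝ≥0∞} (hF : Measurable F) {p : ℝ≥0∞} (hp : 0 < p) (h : eLpNorm F p μ < ∞) :
    ∀ᵐ x ∂μ, F x < ∞ := by
  by_cases htop : p = ∞
  · rw [htop, eLpNorm_exponent_top] at h
    filter_upwards [enorm_ae_le_eLpNormEssSup F μ] with x hx
    exact (show F x ≤ _ from hx).trans_lt h
  · have hp' := ENNReal.toReal_pos hp.ne' htop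
    have h1 := lintegral_rpow_enorm_lt_top_of_eLpNorm_lt_top hp.ne' htop h
    filter_upwards [ae_lt_top (by simpa using hF.pow_const p.toReal) h1.ne] with x hx
    simpa [ENNReal.rpow_lt_top_iff_of_pos hp'] using hx

theorem one_le_eigenvalue (hn : 1 ≤ n) (k : ℕ) : (1 : ℝ≥0∞) ≤ ((2 * k + n : ℕ) : ℝ≥0∞) := by
  exact_mod_cast (by omega : 1 ≤ 2 * k + n)

/-- All eigenvalues are at least `1`, so the weights `ℓ^{2s}` only increase the square function. -/
theorem ae_tsum_hermiteProj_ne_top (hn : 1 ≤ n) {s : ℝ} (hs : 0 ≤ s) {p : ℝ≥0∞} (hp : 0 < p)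
    (h : tlNorm s p 2 f < ∞) : ∀ᵐ x, ∑' k, ‖hermiteProj k f x‖ₑ ^ 2 ≠ ∞ := by
  have hm : Measurable fun x : EuclideanSpace ℝ (Fin n) =>
      (∑' k : ℕ, ((2 * k + n : ℕ) : ℝ≥0∞) ^ (s * 2) * ‖hermiteProj k f x‖ₑ ^ (2 : ℝ)) ^
        (1 / 2 : ℝ) :=
    (Measurable.tsum fun k => ((continuous_hermiteProj k f).measurable.enorm.pow_const
      (2 : ℝ)).const_mul _).pow_const _
  filter_upwards [ae_lt_top_of_eLpNorm_lt_top hm hp h] with x hx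
  rw [ENNReal.rpow_lt_top_iff_of_pos (by norm_num)] at hx
  refine ne_top_of_le_ne_top hx.ne (ENNReal.tsum_le_tsum fun k => ?_)
  rw [ENNReal.rpow_ofNat]
  refine le_mul_of_one_le_left' ?_
  simpa only [ENNReal.rpow_zero] using
    ENNReal.rpow_le_rpow_of_exponent_le (one_le_eigenvalue hn k) (by positivity : 0 ≤ s * 2)

/-- The Sobolev embedding for each `x`, with `(k+1)^{1-2/q} ≤ ℓ^{2s}` because `1 ≤ k + 1 ≤ 2k + n =
ℓ` and `1 - 2/q ≤ 2s`. -/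
theorem exists_mixedNorm_le (hn : 1 ≤ n) (p : ℝ≥0∞) {q : ℝ} (hq : 2 ≤ q) {s : ℝ}
    (hs : 1 / 2 - 1 / q ≤ s) :
    ∃ C : ℝ≥0, 0 < C ∧ ∀ (f : EuclideanSpace ℝ (Fin n) → ℂ)
      (u : ℝ → EuclideanSpace ℝ (Fin n) → ℂ), IsPointwiseFlow f u →
        mixedNorm p (ENNReal.ofReal q) u ≤ C * tlNorm s p 2 f := by
  obtain ⟨C, hC, h⟩ := exists_eLpNorm_le_of_phase_series n hq
  refine ⟨C, hC, fun f u hu => ?_⟩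
  rw [← smul_eq_mul, ← ENNReal.smul_def]
  refine eLpNorm_le_nnreal_smul_eLpNorm_of_ae_le_mul' ?_ p
  filter_upwards [hu.tendsto, hu.ae_aestronglyMeasurable] with x hx hxm
  rw [enorm_eq_self, enorm_eq_self]
  refine (h (fun k => hermiteProj k f x) _ hxm hx).trans ?_
  have hq1 : 2 / q ≤ 1 := (div_le_one (by linarith)).mpr hq
  gcongr with k
  · rw [← ENNReal.ofReal_rpow_of_nonneg (by positivity) (by linarith)]
    calc ENNReal.ofReal ((k : ℝ) + 1) ^ (1 - 2 / q)
        ≤ ((2 * k + n : ℕ) : ℝ≥0∞) ^ (1 - 2 / q) := by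
          refine ENNReal.rpow_le_rpow ?_ (by linarith)
          rw [← ENNReal.ofReal_natCast]
          refine ENNReal.ofReal_le_ofReal ?_
          exact_mod_cast (by omega : k + 1 ≤ 2 * k + n)
      _ ≤ _ := by
          refine ENNReal.rpow_le_rpow_of_exponent_le (one_le_eigenvalue hn k) ?_
          have : 2 / q = 2 * (1 / q) := by ring
          linarith
  · rw [ENNReal.rpow_ofNat]

theorem exists_tlNorm_le (n : ℕ) (p : ℝ≥0∞) {q : ℝ} (hq : 2 ≤ q) :
    ∃ C : ℝ≥0, 0 < C ∧ ∀ (f : EuclideanSpace ℝ (Fin n) → ℂ)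
      (u : ℝ → EuclideanSpace ℝ (Fin n) → ℂ), IsPointwiseFlow f u →
        C * tlNorm 0 p 2 f ≤ mixedNorm p (ENNReal.ofReal q) u := by
  have hr : 0 ≤ 1 / 2 - 1 / q := sub_nonneg.mpr (one_div_le_one_div_of_le two_pos hq)
  -- The Hölder factor from `L^q` to `L²` on `[0, 2π]`; the factor `2π ≥ 1` from Bessel is
  -- discarded.
  set K : ℝ≥0 := (2 * Real.pi).toNNReal ^ (1 / 2 - 1 / q)
  have hK : 0 < K := NNReal.rpow_pos (by positivity)
  have hKe : (K : ℝ≥0∞) = timeMeasure Set.univ ^ (1 / 2 - 1 / q) := by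
    rw [ENNReal.coe_rpow_of_nonneg _ hr, timeMeasure_univ]
    rfl
  refine ⟨K⁻¹, inv_pos.mpr hK, fun f u hu => ?_⟩
  rw [ENNReal.coe_inv hK.ne', mul_comm, ← div_eq_mul_inv]
  refine ENNReal.div_le_of_le_mul ?_
  rw [mul_comm, ← smul_eq_mul, ← ENNReal.smul_def]
  refine eLpNorm_le_nnreal_smul_eLpNorm_of_ae_le_mul' ?_ p
  filter_upwards [hu.tendsto, hu.ae_aestronglyMeasurable] with x hx hxm
  rw [enorm_eq_self, enorm_eq_self]
  have h1 := (isOrthogonal_phase_mul n fun k => hermiteProj k f x).tsum_le_eLpNorm_sq hxm hx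
  simp_rw [eLpNorm_phase_mul_sq] at h1
  have hpi : (1 : ℝ≥0∞) ≤ ENNReal.ofReal (2 * Real.pi) := by
    rw [ENNReal.one_le_ofReal]
    linarith [Real.pi_gt_three]
  have h2 : ∑' k, ‖hermiteProj k f x‖ₑ ^ 2 ≤ eLpNorm (fun t => u t x) 2 timeMeasure ^ 2 :=
    (ENNReal.tsum_le_tsum fun k => le_mul_of_one_le_left' hpi).trans h1
  have h3 := eLpNorm_le_eLpNorm_mul_rpow_measure_univ (p := 2) (q := ENNReal.ofReal q)
    (by rw [← ENNReal.ofReal_ofNat]; exact ENNReal.ofReal_le_ofReal hq) hxm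
  rw [ENNReal.toReal_ofReal (by linarith), ENNReal.toReal_ofNat, ← hKe, mul_comm] at h3
  refine le_trans ?_ h3
  simp only [zero_mul, ENNReal.rpow_zero, one_mul, ENNReal.rpow_ofNat]
  refine (ENNReal.pow_le_pow_left_iff two_ne_zero).mp ?_
  rwa [rpow_half_sq]

end MixedNorm

end HermiteTL

theorem mainTheorem4 (n : ℕ) (hn : 1 ≤ n) (p : ℝ≥0∞) (hp : 0 < p) (q : ℝ) (hq : 2 ≤ q) :
    (∃ C' : ℝ≥0, 0 < C' ∧
      ∀ f : EuclideanSpace ℝ (Fin n) → ℂ, HermiteTL.HasHermiteCoeffs f →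
        ∀ u : ℝ → EuclideanSpace ℝ (Fin n) → ℂ,
          (HermiteTL.IsPointwiseFlow f u ∨ HermiteTL.IsL2Flow f u) →
            (C' : ℝ≥0∞) * HermiteTL.tlNorm 0 p 2 f ≤
              HermiteTL.mixedNorm p (ENNReal.ofReal q) u) ∧
    (∀ s : ℝ, 1 / 2 - 1 / q ≤ s →
      ∃ C : ℝ≥0, 0 < C ∧
        ∀ f : EuclideanSpace ℝ (Fin n) → ℂ, HermiteTL.HasHermiteCoeffs f →
          (HermiteTL.tlNorm s p 2 f < ∞ →
            ∃ u : ℝ → EuclideanSpace ℝ (Fin n) → ℂ, HermiteTL.IsPointwiseFlow f u ∧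
              (MemLp f 2 volume → HermiteTL.IsL2Flow f u)) ∧
          ∀ u : ℝ → EuclideanSpace ℝ (Fin n) → ℂ,
            (HermiteTL.IsPointwiseFlow f u ∨ HermiteTL.IsL2Flow f u) →
              HermiteTL.mixedNorm p (ENNReal.ofReal q) u ≤
                (C : ℝ≥0∞) * HermiteTL.tlNorm s p 2 f) := by
  constructor
  · obtain ⟨C, hC, h⟩ := HermiteTL.exists_tlNorm_le n p hq
    exact ⟨C, hC, fun f _ u hu => h f u (HermiteTL.IsPointwiseFlow.of_or hu)⟩
  · intro s hs
    obtain ⟨C, hC, h⟩ := HermiteTL.exists_mixedNorm_le hn p hq hs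
    refine ⟨C, hC, fun f _ => ⟨fun hf => ?_, fun u hu =>
      h f u (HermiteTL.IsPointwiseFlow.of_or hu)⟩⟩
    have hs0 : 0 ≤ s := (sub_nonneg.mpr (one_div_le_one_div_of_le two_pos hq)).trans hs
    obtain ⟨u, hu⟩ := HermiteTL.exists_isPointwiseFlow
      (HermiteTL.ae_tsum_hermiteProj_ne_top hn hs0 hp hf)
    exact ⟨u, hu, fun hf2 => (HermiteTL.isPointwiseFlow_iff_isL2Flow hf2).mp hu⟩
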